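/- A *binary signal* is a right-continuous function $s:[0,\infty)\to\{0,1\}$ with left limits, together with an *initial value* $s(0-)\in\{0,1\}$. It has a rising (falling) *transition* at $t\ge 0$ if its left limit at $t$ (for $t=0$: its initial value) is $0$ (resp. $1$) and $s(t)=1$ (resp. $s(t)=0$). It *contains a pulse* of length $\Delta>0$ at $T_0$ if it has a rising transition at $T_0$, a falling one at $T_0+\Delta$ and none in between; it *is a pulse* if in addition $s(0-)=0$ and it has no other transition. The *zero signal* has initial value $0$ and no transitions. A *digitized hybrid gate* with $c$ inputs consists of: pure delays $\delta_1,\dots,\delta_c\ge 0$; an open set $U\subseteq\mathbb{R}^n$, $n\ge 1$; a set $F$ of functions $f:[0,\infty)\times U\to\mathbb{R}^n$; a choice function $a_c:\{0,1\}^c\to F$; an initial state $x_0\in U$ for every vector of initial values of the inputs; and a threshold $\xi\in(0,1)$. For every $T>0$, all $f\in F$ are bounded and continuous on $[0,T]\times U$, and Lipschitz continuous in $x\in U$ with a Lipschitz constant that is common to all $f\in F$ and all $t\in[0,T]$. Moreover, for all $f\in F$ and $0\le s<T$: for every $y\in U$ the equation $\dot x(t)=f(t,x(t))$, $x(s)=y$,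 has a solution on $[s,T]$ that stays in $U$, and for every solution $x:[s,T]\to U$ the first coordinate $\pi_1\circ x$ has only finitely many local optima in $(s,T)$. The gate is *strictly causal* if all its $\delta_j$ are positive. Given input signals $i^1,\dots,i^c$, let $i_d^j(t)=i^j(0-)$ for $t<\delta_j$ and $i_d^j(t)=i^j(t-\delta_j)$ for $t\ge\delta_j$; let $a_t=a_c(i_d^1(t),\dots,i_d^c(t))$, and let $x:[0,\infty)\to U$ be the continuous function with $x(0)=x_0$, for the $x_0$ that belongs to $(i^1(0-),\dots,i^c(0-))$, and with $\dot x(t)=a_t(t,x(t))$ at all $t>0$ at which $a$ is continuous (i.e. locally constant). The *output* of the gate is the binary signal whose value at $t\ge0$ is $\lim_{u\to t+}\Theta_\xi(\pi_1(x(u)))$ and whose initial value is $\Theta_\xi(\pi_1(x_0))$, where $\Theta_\xi(v)=1$ if $v>\xi$ and $\Theta_\xi(v)=0$ otherwise. A *circuit* consists of finitely many input ports, output ports and digitized hybrid gates, where every gate input and every output port is driven by exactly one input port or gate; feedback loops are allowed. An *execution* assigns a binary signal to every input port, gate and output port such that every gate's signal is the output of that gate on the signals of its drivers, and every output port carries the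 signal of its driver. A circuit *solves bounded Short-Pulse Filtration* if * (F1) it has exactly one input port and exactly one output port; * (F2) in every execution in which the input is the zero signal, so is the output; * (F3) there is an execution in which the input is a pulse and the output is not the zero signal; * (F4) there is an $\varepsilon>0$ such that in every execution in which the input is a pulse, the output contains no pulse of length at most $\varepsilon$; * (F5) there is a $K>0$ such that in every execution in which the input is a pulse, of length $\Delta$ at time $T_0$, every output transition takes place before time $T_0+\Delta+K$. **Theorem.** No circuit made up of strictly causal digitized hybrid gates, with or without feedback loops, solves bounded Short-Pulse Filtration. -/

import Mathlib

open Filter Set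
open scoped Topology NNReal

noncomputable section

namespace HybridCircuit

/-! ### Binary signals -/

/-- A binary signal on `[0, ∞)` together with its initial value (its value "at `0-`").
The function is extended to negative times by the initial value; on `[0, ∞)` it is
right-continuous and has left limits (the codomain is discrete). -/
structure Signal where
  toFun : ℝ → Bool
  init : Bool
  eq_init : ∀ t < 0, toFun t = init
  right_cont : ∀ t, 0 ≤ t → ∀ᶠ u in 𝓝[>] t, toFun u = toFun t
  left_lim : ∀ t, 0 < t → ∃ b, ∀ᶠ u in 𝓝[<] t, toFun u = b

namespace Signal

/-- A rising transition `(t, 1)`. At `t = 0` the left limit is the initial value. -/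
def Rising (s : Signal) (t : ℝ) : Prop :=
  (∀ᶠ u in 𝓝[<] t, s.toFun u = false) ∧ s.toFun t = true

/-- A falling transition `(t, 0)`. At `t = 0` the left limit is the initial value. -/
def Falling (s : Signal) (t : ℝ) : Prop :=
  (∀ᶠ u in 𝓝[<] t, s.toFun u = true) ∧ s.toFun t = false

/-- The signal has a transition at time `t`. -/
def Transition (s : Signal) (t : ℝ) : Prop := s.Rising t ∨ s.Falling t

/-- The signal contains a pulse of length `Δ` at time `T₀`. -/
def ContainsPulse (s : Signal) (T₀ Δ : ℝ) : Prop :=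
  0 < Δ ∧ s.Rising T₀ ∧ s.Falling (T₀ + Δ) ∧ ∀ t ∈ Ioo T₀ (T₀ + Δ), ¬ s.Transition t

/-- The zero signal: initial value `0` and no transition. -/
def IsZero (s : Signal) : Prop := s.init = false ∧ ∀ t, ¬ s.Transition t

/-- The signal is a single pulse of length `Δ` at time `T₀`: its initial value is `0`, it
contains this pulse, and it has no other transition. -/
def IsPulse (s : Signal) (T₀ Δ : ℝ) : Prop :=
  s.init = false ∧ s.ContainsPulse T₀ Δ ∧ ∀ t, s.Transition t → t = T₀ ∨ t = T₀ + Δ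

/-- The pure delay function `Δ_δ`. -/
def delayed (δ : ℝ) (s : Signal) (t : ℝ) : Bool :=
  if t < δ then s.init else s.toFun (t - δ)

end Signal

/-! ### Mode-switched differential equations -/

/-- The state space `ℝ^(m+1)` with its Euclidean norm. -/
abbrev State (m : ℕ) : Type := EuclideanSpace ℝ (Fin (m + 1))

/-- `x` is a trajectory in `U` of `dx/dt = f(t, x)` on the time interval `[s, T]`. -/
def IsTrajectory {m : ℕ} (f : ℝ → State m → State m) (U : Set (State m)) (s T : ℝ)
    (x : ℝ → State m) : Prop :=
  ContinuousOn x (Icc s T) ∧ (∀ t ∈ Icc s T, x t ∈ U) ∧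
    ∀ t ∈ Ioo s T, HasDerivAt x (f t (x t)) t

/-- `x : [0, ∞) → U` is a matching output signal for the mode-switch signal `a` with initial
value `x₀`: it is continuous and solves `dx/dt = a_t(t, x)` at every time `t > 0` at which `a`
does not jump. -/
def IsMatchingOutput {m : ℕ} (a : ℝ → ℝ → State m → State m) (U : Set (State m))
    (x₀ : State m) (x : ℝ → State m) : Prop :=
  (∀ t, 0 ≤ t → x t ∈ U) ∧ x 0 = x₀ ∧ ContinuousOn x (Ici 0) ∧
    ∀ t, 0 < t → (∀ᶠ u in 𝓝 t, a u = a t) → HasDerivAt x (a t t (x t)) t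

/-- The comparator: `1` if the voltage exceeds `ξ`, and `0` otherwise. -/
def threshold (ξ v : ℝ) : Bool := decide (ξ < v)

/-! ### Digitized hybrid gates -/

/-- A digitized hybrid gate. The mode functions `f ∈ F` are considered on `[0, ∞) × U` only. -/
structure Gate where
  /-- the number `c` of inputs -/
  arity : ℕ
  /-- the pure delays of the inputs -/
  delay : Fin arity → ℝ
  delay_nonneg : ∀ j, 0 ≤ delay j
  /-- the state space is a subset of `ℝ^(m+1)`; coordinate `0` is the analog output -/
  m : ℕ
  U : Set (State m)
  isOpen_U : IsOpen U
  /-- the set of right-hand sides of the differential equations of the modes -/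
  F : Set (ℝ → State m → State m)
  bounded : ∀ f ∈ F, ∀ T : ℝ, ∃ M : ℝ, ∀ t ∈ Icc 0 T, ∀ x ∈ U, ‖f t x‖ ≤ M
  cont : ∀ f ∈ F, ContinuousOn (fun p : ℝ × State m => f p.1 p.2) (Ici 0 ×ˢ U)
  lipschitz : ∀ T : ℝ, ∃ K : ℝ≥0, ∀ f ∈ F, ∀ t ∈ Icc 0 T, LipschitzOnWith K (f t) U
  /-- trajectories that start in `U` exist and stay in `U` -/
  stays : ∀ f ∈ F, ∀ s T : ℝ, 0 ≤ s → s < T → ∀ y ∈ U,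
    ∃ x : ℝ → State m, x s = y ∧ IsTrajectory f U s T x
  /-- the analog output has finitely many local optima along a trajectory on a bounded interval
  (weaker than finitely many critical points, as every interior local optimum is critical) -/
  finite_optima : ∀ f ∈ F, ∀ s T : ℝ, 0 ≤ s → s < T → ∀ x : ℝ → State m,
    IsTrajectory f U s T x → {t ∈ Ioo s T | IsLocalExtr (fun u => x u 0) t}.Finite
  /-- the choice function `a_c` that selects the mode -/
  choice : (Fin arity → Bool) → ℝ → State m → State m
  choice_mem : ∀ b, choice b ∈ F
  /-- the initial state, depending on the initial values of the inputs -/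
  x₀ : (Fin arity → Bool) → State m
  x₀_mem : ∀ b, x₀ b ∈ U
  /-- the threshold of the comparator -/
  ξ : ℝ
  ξ_mem : ξ ∈ Ioo (0 : ℝ) 1

namespace Gate

/-- All pure delays are positive. -/
def StrictlyCausal (G : Gate) : Prop := ∀ j, 0 < G.delay j

/-- The mode-switch signal that the input signals induce. -/
def modeSwitch (G : Gate) (i : Fin G.arity → Signal) (t : ℝ) : ℝ → State G.m → State G.m :=
  G.choice fun j => (i j).delayed (G.delay j) t

/-- The graph of the gate function: `o` is the digitized output of `G` on the inputs `i`.
Since `Θ_ξ ∘ π₁ ∘ x` is not right-continuous at an upward crossing of the threshold, `o` is its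
right-continuous version; the initial value of `o` is the digitized initial state. -/
def IsOutput (G : Gate) (i : Fin G.arity → Signal) (o : Signal) : Prop :=
  ∃ x : ℝ → State G.m,
    IsMatchingOutput (G.modeSwitch i) G.U (G.x₀ fun j => (i j).init) x ∧
    o.init = threshold G.ξ (x 0 0) ∧
    ∀ t, 0 ≤ t → ∀ᶠ u in 𝓝[>] t, o.toFun u = threshold G.ξ (x u 0)

end Gate

/-! ### Circuits and executions -/

/-- A circuit of finitely many digitized hybrid gates; arbitrary feedback is allowed. The edges
are given by the unique driver (an input port or a gate) of every gate input and of every output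
port. -/
structure Circuit where
  InPort : Type
  OutPort : Type
  Node : Type
  finite_in : Finite InPort
  finite_out : Finite OutPort
  finite_node : Finite Node
  gate : Node → Gate
  src : (g : Node) → Fin (gate g).arity → InPort ⊕ Node
  outSrc : OutPort → InPort ⊕ Node

namespace Circuit

/-- All gates are strictly causal. -/
def StrictlyCausal (C : Circuit) : Prop := ∀ g, (C.gate g).StrictlyCausal

/-- An execution: a signal for every vertex, respecting all gate functions and output ports;
signals at input ports are arbitrary. -/
structure Execution (C : Circuit) where
  inp : C.InPort → Signal
  node : C.Node → Signal
  out : C.OutPort → Signal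
  out_eq : ∀ o, out o = Sum.elim inp node (C.outSrc o)
  gate_out : ∀ g, (C.gate g).IsOutput (fun j => Sum.elim inp node (C.src g j)) (node g)

variable {C : Circuit}

/-- The input is the zero signal. -/
def Execution.ZeroInput (e : C.Execution) : Prop := ∀ i, (e.inp i).IsZero

/-- The input is a single pulse of length `Δ` at time `T₀`. -/
def Execution.PulseInput (e : C.Execution) (T₀ Δ : ℝ) : Prop := ∀ i, (e.inp i).IsPulse T₀ Δ

/-- The circuit solves Short-Pulse Filtration. -/
structure SolvesSPF (C : Circuit) : Prop where
  wellFormed : Nat.card C.InPort = 1 ∧ Nat.card C.OutPort = 1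
  noGeneration : ∀ e : C.Execution, e.ZeroInput → ∀ o, (e.out o).IsZero
  nontriviality : ∃ (e : C.Execution) (T₀ Δ : ℝ), e.PulseInput T₀ Δ ∧ ∃ o, ¬ (e.out o).IsZero
  noShortPulses : ∃ ε : ℝ, 0 < ε ∧ ∀ (e : C.Execution) (T₀ Δ : ℝ), e.PulseInput T₀ Δ →
    ∀ (o : C.OutPort) (t l : ℝ), (e.out o).ContainsPulse t l → ε < l

/-- The circuit solves bounded Short-Pulse Filtration: the output moreover stabilizes within
bounded time. -/
structure SolvesBoundedSPF (C : Circuit) : Prop extends C.SolvesSPF where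
  boundedStabilization : ∃ K : ℝ, 0 < K ∧ ∀ (e : C.Execution) (T₀ Δ : ℝ), e.PulseInput T₀ Δ →
    ∀ (o : C.OutPort) (t : ℝ), (e.out o).Transition t → t < T₀ + Δ + K

end Circuit

end HybridCircuit

end

/-!
The outputs of a circuit depend continuously on the length of the input pulse, whereas bounded
Short-Pulse Filtration would force a jump.

Signals are compared by convergence at almost every time: a family of signals converges to `s` if,
for almost every `t`, its values at `t` are eventually equal to `s t`. A gate preserves this notion
of convergence. Indeed, if the mode signals converge almost everywhere, then the mode functions
along the limit trajectory converge almost everywhere and boundedly, hence in `L¹`, and Grönwall's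
inequality gives convergence of the trajectories (`Gate.exists_norm_sub_le`,
`Gate.tendsto_trajectory`). Since the analog output of a gate has finitely many local optima while
the mode is constant, Rolle's theorem shows that it meets the threshold on a countable set only,
and away from this set the digitized outputs converge (`Gate.ae_eventually_output_eq`). The same
lemma, applied to a constant family, shows that a strictly causal gate determines its output up to
time `T + δ` from its inputs before time `T`. So executions with prescribed consistent initial
values are obtained by iterating the gate map (`Circuit.exists_execution`), and an induction on
multiples of the least delay shows that they depend continuously on the input
(`Circuit.ae_eventually_out_eq`).

Now suppose that a circuit solves bounded Short-Pulse Filtration, and let `e₁` be an execution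
whose input is a pulse of length `Δ₁` and whose output is not zero. Keep the initial values of
`e₁`, and let the pulse length `Δ` range over `[0, Δ₁]`, where `Δ = 0` stands for the zero signal.
The output is zero at `Δ = 0`. The lengths with a nonzero output form an open set, as a signal that
takes the value `1` does so on an interval. They also form a closed set: a nonzero output rises
before time `T₀ + Δ₁ + K` and then stays `1` for time `ε`, so it is seen by a fixed finite set of
sample times, at which the outputs near a zero output vanish. This contradicts the connectedness of
`[0, Δ₁]`.
-/

namespace HybridCircuit

/-! ### Real analysis -/

/-- Grönwall's inequality in integral form. -/
lemma le_mul_exp_of_le_add_integral {r : ℝ → ℝ} {T E K : ℝ} (hT : 0 ≤ T) (hK : 0 ≤ K)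
    (hr : ContinuousOn r (Icc 0 T)) (h0 : ∀ t ∈ Icc 0 T, 0 ≤ r t)
    (h : ∀ t ∈ Icc 0 T, r t ≤ E + K * ∫ u in (0 : ℝ)..t, r u) :
    ∀ t ∈ Icc 0 T, r t ≤ E * Real.exp (K * t) := by
  have hq : Continuous (IccExtend hT ((Icc 0 T).domRestrict r)) := hr.domRestrict.Icc_extend'
  set q := IccExtend hT ((Icc 0 T).domRestrict r) with hqdef
  have hqr : ∀ t ∈ Icc 0 T, q t = r t := fun t ht => by
    rw [hqdef, IccExtend_of_mem hT _ ht]; rfl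
  have hint : ∀ t ∈ Icc 0 T, ∫ u in (0 : ℝ)..t, r u = ∫ u in (0 : ℝ)..t, q u := fun t ht => by
    refine intervalIntegral.integral_congr fun u hu => ?_
    rw [uIcc_of_le ht.1] at hu
    exact (hqr u ⟨hu.1, hu.2.trans ht.2⟩).symm
  have hq0 : ∀ t, 0 ≤ q t := fun t => h0 _ (projIcc 0 T hT t).2
  have hderiv : ∀ t, HasDerivAt (fun t => ∫ u in (0 : ℝ)..t, q u) (q t) t := fun t =>
    intervalIntegral.integral_hasDerivAt_right (hq.intervalIntegrable _ _)
      (hq.stronglyMeasurableAtFilter _ _) hq.continuousAt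
  have hpos : ∀ t ∈ Icc 0 T, 0 ≤ ∫ u in (0 : ℝ)..t, q u := fun t ht =>
    intervalIntegral.integral_nonneg ht.1 fun u _ => hq0 u
  have key := norm_le_gronwallBound_of_norm_deriv_right_le (f := fun t => ∫ u in (0 : ℝ)..t, q u)
    (f' := q) (δ := 0) (K := K) (ε := E) (a := 0) (b := T)
    (fun t _ => (hderiv t).continuousAt.continuousWithinAt)
    (fun t _ => (hderiv t).hasDerivWithinAt) (by simp)
    (fun t ht => by
      have ht' : t ∈ Icc 0 T := ⟨ht.1, ht.2.le⟩
      have := h t ht'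
      rw [hint t ht', ← hqr t ht'] at this
      rw [Real.norm_of_nonneg (hq0 t), Real.norm_of_nonneg (hpos t ht')]
      linarith)
  intro t ht
  have h1 := key t ht
  have h2 := h t ht
  rw [hint t ht] at h2
  rw [Real.norm_of_nonneg (hpos t ht), sub_zero] at h1
  rcases eq_or_ne K 0 with rfl | hK0
  · simpa using h2
  · rw [gronwallBound_of_K_ne_0 hK0] at h1
    have h3 : K * (∫ u in (0 : ℝ)..t, q u) ≤ E * (Real.exp (K * t) - 1) := by
      calc _ ≤ K * (0 * Real.exp (K * t) + E / K * (Real.exp (K * t) - 1)) :=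
            mul_le_mul_of_nonneg_left h1 hK
        _ = _ := by field_simp; ring
    linarith

/-- Real induction on `[0, ∞)`. -/
lemma forall_nonneg_of_step {P : ℝ → Prop} (h0 : P 0)
    (hl : ∀ t, 0 < t → (∀ s, 0 ≤ s → s < t → P s) → P t)
    (hr : ∀ s, 0 ≤ s → P s → ∃ T, s < T ∧ ∀ t ∈ Ioo s T, P t) : ∀ t, 0 ≤ t → P t := by
  by_contra! hcon
  obtain ⟨t₁, ht₁, hP₁⟩ := hcon
  set B : Set ℝ := {t | 0 ≤ t ∧ ¬ P t}
  have hB : B.Nonempty := ⟨t₁, ht₁, hP₁⟩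
  have hbdd : BddBelow B := ⟨0, fun t ht => ht.1⟩
  have hpos : 0 ≤ sInf B := le_csInf hB fun t ht => ht.1
  have hlt : ∀ s, 0 ≤ s → s < sInf B → P s := fun s hs hsB => by
    by_contra hPs
    exact absurd (csInf_le hbdd ⟨hs, hPs⟩) (not_le.2 hsB)
  have hPB : P (sInf B) := by
    rcases hpos.eq_or_lt with h | h
    · rwa [← h]
    · exact hl _ h hlt
  obtain ⟨T, hT, hPT⟩ := hr _ hpos hPB
  obtain ⟨t, ht, htT⟩ := exists_lt_of_csInf_lt hB hT
  rcases (csInf_le hbdd ht).eq_or_lt with h | h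
  · exact ht.2 (h ▸ hPB)
  · exact ht.2 (hPT t ⟨h, htT⟩)

lemma countable_of_eventually_nhdsGT_notMem {S : Set ℝ}
    (h : ∀ t ∈ S, ∀ᶠ u in 𝓝[>] t, u ∉ S) : S.Countable := by
  refine (countable_setOfPred_isolated_right_within (s := S)).mono fun t ht => ?_
  refine mem_ofPred_eq ▸ And.intro ht ?_
  rw [inter_comm, nhdsWithin_inter']
  exact Filter.inf_principal_eq_bot.2 (h t ht)

lemma eventually_nhdsGT_eventually_nhds {p : ℝ → Prop} {t : ℝ} (h : ∀ᶠ u in 𝓝[>] t, p u) :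
    ∀ᶠ u in 𝓝[>] t, ∀ᶠ v in 𝓝 u, p v := by
  filter_upwards [eventually_eventually_nhdsWithin.2 h, self_mem_nhdsWithin] with u hu hut
  rwa [IsOpen.nhdsWithin_eq isOpen_Ioi hut] at hu

lemma eventually_nhdsLT_eventually_nhds {p : ℝ → Prop} {t : ℝ} (h : ∀ᶠ u in 𝓝[<] t, p u) :
    ∀ᶠ u in 𝓝[<] t, ∀ᶠ v in 𝓝 u, p v := by
  filter_upwards [eventually_eventually_nhdsWithin.2 h, self_mem_nhdsWithin] with u hu hut
  rwa [IsOpen.nhdsWithin_eq isOpen_Iio hut] at hu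

lemma exists_Ioo_of_eventually_nhdsGT {p : ℝ → Prop} {t : ℝ} (h : ∀ᶠ u in 𝓝[>] t, p u) :
    ∃ T, t < T ∧ ∀ u ∈ Ioo t T, p u :=
  mem_nhdsGT_iff_exists_Ioo_subset.1 h

lemma exists_Ioo_of_eventually_nhdsLT {p : ℝ → Prop} {t : ℝ} (h : ∀ᶠ u in 𝓝[<] t, p u) :
    ∃ T, T < t ∧ ∀ u ∈ Ioo T t, p u :=
  mem_nhdsLT_iff_exists_Ioo_subset.1 h

lemma eventually_nhdsGT_notMem_of_finite {A : Set ℝ} {s : ℝ} (hA : A.Finite) (hs : s ∉ A) :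
    ∀ᶠ u in 𝓝[>] s, u ∉ A :=
  nhdsWithin_le_nhds (hA.isClosed.isOpen_compl.mem_nhds hs)

lemma eventually_nhdsLT_notMem_of_finite {A : Set ℝ} {s : ℝ} (hA : A.Finite) (hs : s ∉ A) :
    ∀ᶠ u in 𝓝[<] s, u ∉ A :=
  nhdsWithin_le_nhds (hA.isClosed.isOpen_compl.mem_nhds hs)

/-- By Rolle's theorem, a level set contains at most one point of an interval that is free of
local extrema. -/
lemma finite_level_of_forall_not_isLocalExtr {g : ℝ → ℝ} {s T ξ : ℝ}
    (hg : ContinuousOn g (Ioo s T)) (hext : ∀ u ∈ Ioo s T, ¬ IsLocalExtr g u) :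
    {u ∈ Ioo s T | g u = ξ}.Finite := by
  refine Set.Subsingleton.finite fun a ha b hb => ?_
  by_contra hne
  wlog hab : a < b generalizing a b
  · exact this b hb a ha (Ne.symm hne) (lt_of_le_of_ne (not_lt.1 hab) (Ne.symm hne))
  obtain ⟨c, hc, hc'⟩ := exists_isLocalExtr_Ioo hab
    (hg.mono fun u hu => ⟨ha.1.1.trans_le hu.1, hu.2.trans_lt hb.1.2⟩) (ha.2.trans hb.2.symm)
  exact hext c ⟨ha.1.1.trans hc.1, hc.2.trans hb.1.2⟩ hc'

lemma eventually_ne_nhdsGT_of_finite_extr {g : ℝ → ℝ} {s T ξ : ℝ} (hsT : s < T)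
    (hg : ContinuousOn g (Icc s T)) (hext : {t ∈ Ioo s T | IsLocalExtr g t}.Finite) :
    ∀ᶠ u in 𝓝[>] s, g u ≠ ξ := by
  obtain ⟨T', hT', hs⟩ := exists_Ioo_of_eventually_nhdsGT
    ((eventually_nhdsGT_notMem_of_finite hext (s := s) (by simp)).and (Ioo_mem_nhdsGT hsT))
  have hfin := finite_level_of_forall_not_isLocalExtr (ξ := ξ)
    (hg.mono fun u hu => Ioo_subset_Icc_self (hs u hu).2)
    (fun u hu hc => (hs u hu).1 ⟨(hs u hu).2, hc⟩)
  filter_upwards [eventually_nhdsGT_notMem_of_finite hfin (s := s) (by simp), Ioo_mem_nhdsGT hT']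
    with u hu hu' h using hu ⟨hu', h⟩

lemma eventually_ne_nhdsLT_of_finite_extr {g : ℝ → ℝ} {s T ξ : ℝ} (hsT : s < T)
    (hg : ContinuousOn g (Icc s T)) (hext : {t ∈ Ioo s T | IsLocalExtr g t}.Finite) :
    ∀ᶠ u in 𝓝[<] T, g u ≠ ξ := by
  obtain ⟨s', hs', hs⟩ := exists_Ioo_of_eventually_nhdsLT
    ((eventually_nhdsLT_notMem_of_finite hext (s := T) (by simp)).and (Ioo_mem_nhdsLT hsT))
  have hfin := finite_level_of_forall_not_isLocalExtr (ξ := ξ)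
    (hg.mono fun u hu => Ioo_subset_Icc_self (hs u hu).2)
    (fun u hu hc => (hs u hu).1 ⟨(hs u hu).2, hc⟩)
  filter_upwards [eventually_nhdsLT_notMem_of_finite hfin (s := T) (by simp), Ioo_mem_nhdsLT hs']
    with u hu hu' h using hu ⟨hu', h⟩

/-- A local version of `hasDerivAt_of_hasDerivAt_of_ne`. -/
lemma hasDerivAt_of_eventually_hasDerivAt_nhdsNE {E : Type*} [NormedAddCommGroup E]
    [NormedSpace ℝ E] {f g : ℝ → E} {t : ℝ} (hd : ∀ᶠ u in 𝓝[≠] t, HasDerivAt f (g u) u)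
    (hf : ContinuousAt f t) (hg : ContinuousAt g t) : HasDerivAt f (g t) t := by
  have hdr : ∀ᶠ u in 𝓝[>] t, HasDerivAt f (g u) u :=
    hd.filter_mono (nhdsWithin_mono _ fun u hu => ne_of_gt hu)
  have hdl : ∀ᶠ u in 𝓝[<] t, HasDerivAt f (g u) u :=
    hd.filter_mono (nhdsWithin_mono _ fun u hu => ne_of_lt hu)
  have A : HasDerivWithinAt f (g t) (Ici t) t :=
    hasDerivWithinAt_Ici_of_tendsto_deriv
      (fun u hu => DifferentiableAt.differentiableWithinAt (HasDerivAt.differentiableAt hu))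
      hf.continuousWithinAt hdr
      ((hg.tendsto.mono_left nhdsWithin_le_nhds).congr' (hdr.mono fun u hu => hu.deriv.symm))
  have B : HasDerivWithinAt f (g t) (Iic t) t :=
    hasDerivWithinAt_Iic_of_tendsto_deriv
      (fun u hu => DifferentiableAt.differentiableWithinAt (HasDerivAt.differentiableAt hu))
      hf.continuousWithinAt hdl
      ((hg.tendsto.mono_left nhdsWithin_le_nhds).congr' (hdl.mono fun u hu => hu.deriv.symm))
  simpa using B.union A

/-! ### The comparator -/

lemma eventually_threshold_eq {κ : Type*} {l : Filter κ} {g : κ → ℝ} {v ξ : ℝ}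
    (hg : Tendsto g l (𝓝 v)) (hv : v ≠ ξ) :
    ∀ᶠ k in l, g k ≠ ξ ∧ threshold ξ (g k) = threshold ξ v := by
  rcases lt_or_gt_of_ne hv with h | h
  · filter_upwards [hg.eventually_lt_const h] with k hk
    exact ⟨hk.ne, by simp [threshold, not_lt.2 hk.le, not_lt.2 h.le]⟩
  · filter_upwards [hg.eventually_const_lt h] with k hk
    exact ⟨hk.ne', by simp [threshold, hk, h]⟩

lemma exists_threshold_eq_of_ne {g : ℝ → ℝ} {s T ξ : ℝ} (hg : ContinuousOn g (Ioo s T))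
    (hne : ∀ u ∈ Ioo s T, g u ≠ ξ) : ∃ c, ∀ u ∈ Ioo s T, threshold ξ (g u) = c := by
  rcases le_or_gt T s with h | h
  · exact ⟨true, by simp [Ioo_eq_empty_of_le h]⟩
  have hc : ContinuousOn (fun u => threshold ξ (g u)) (Ioo s T) := fun u hu => by
    refine tendsto_nhds_of_eventually_eq ?_
    filter_upwards [eventually_threshold_eq (hg u hu) (hne u hu)] with v hv using hv.2
  obtain ⟨w, hw⟩ := nonempty_Ioo.2 h
  exact ⟨_, fun u hu => isPreconnected_Ioo.constant hc hu hw⟩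

/-! ### Piecewise constant functions -/

/-- Functions that are locally constant on either side of every point, and right-continuous. -/
structure Regulated {α : Type*} (b : ℝ → α) : Prop where
  right : ∀ t, ∀ᶠ u in 𝓝[>] t, b u = b t
  left : ∀ t, ∃ c, ∀ᶠ u in 𝓝[<] t, b u = c

namespace Regulated

variable {α : Type*} {b : ℝ → α}

lemma countable_jumps (hb : Regulated b) : {t | ¬ ∀ᶠ u in 𝓝 t, b u = b t}.Countable := by
  refine countable_of_eventually_nhdsGT_notMem fun t _ => ?_
  filter_upwards [eventually_nhdsGT_eventually_nhds (hb.right t), hb.right t] with u hu hut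
  simpa [hut] using hu

lemma comp_sub (hb : Regulated b) (d : ℝ) : Regulated fun t => b (t - d) where
  right t := by
    have : Tendsto (fun u => u - d) (𝓝[>] t) (𝓝[>] (t - d)) :=
      tendsto_nhdsWithin_iff.2 ⟨((continuous_sub_right d).tendsto t).mono_left nhdsWithin_le_nhds,
        eventually_nhdsWithin_of_forall fun u hu => sub_lt_sub_right hu d⟩
    exact this.eventually (hb.right (t - d))
  left t := by
    have : Tendsto (fun u => u - d) (𝓝[<] t) (𝓝[<] (t - d)) :=
      tendsto_nhdsWithin_iff.2 ⟨((continuous_sub_right d).tendsto t).mono_left nhdsWithin_le_nhds,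
        eventually_nhdsWithin_of_forall fun u hu => sub_lt_sub_right hu d⟩
    obtain ⟨c, hc⟩ := hb.left (t - d)
    exact ⟨c, this.eventually hc⟩

lemma pi {ι : Type*} [Finite ι] {b : ι → ℝ → α} (hb : ∀ j, Regulated (b j)) :
    Regulated fun t j => b j t where
  right t := by
    filter_upwards [eventually_all.2 fun j => (hb j).right t] with u hu using funext hu
  left t := by
    choose c hc using fun j => (hb j).left t
    refine ⟨c, ?_⟩
    filter_upwards [eventually_all.2 hc] with u hu using funext hu

end Regulated

namespace Signal

lemma regulated (s : Signal) : Regulated s.toFun where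
  right t := by
    rcases le_or_gt 0 t with h | h
    · exact s.right_cont t h
    · filter_upwards [nhdsWithin_le_nhds (Iio_mem_nhds h)] with u hu
      rw [s.eq_init u hu, s.eq_init t h]
  left t := by
    rcases lt_or_ge 0 t with h | h
    · exact s.left_lim t h
    · refine ⟨s.init, ?_⟩
      filter_upwards [self_mem_nhdsWithin] with u hu using s.eq_init u (lt_of_lt_of_le hu h)

lemma delayed_eq (s : Signal) (δ t : ℝ) : s.delayed δ t = s.toFun (t - δ) := by
  unfold delayed
  split_ifs with h
  · exact (s.eq_init _ (sub_neg.2 h)).symm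
  · rfl

end Signal

/-! ### Trajectories of a gate on a bounded time interval -/

namespace Gate

variable (G : Gate)

/-- The joint values of the delayed inputs of a gate; they select the mode. -/
noncomputable def delayedInputs (i : Fin G.arity → Signal) (t : ℝ) : Fin G.arity → Bool :=
  fun j => (i j).delayed (G.delay j) t

lemma regulated_delayedInputs (i : Fin G.arity → Signal) : Regulated (G.delayedInputs i) :=
  Regulated.pi fun j => by
    simpa only [delayedInputs, Signal.delayed_eq] using (i j).regulated.comp_sub (G.delay j)

/-- `x` solves the mode-switched equation on `[0, T]`, where `b t` selects the mode at time `t`. -/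
structure IsTrajectoryOn (b : ℝ → Fin G.arity → Bool) (y₀ : State G.m) (T : ℝ)
    (x : ℝ → State G.m) : Prop where
  mem : ∀ t ∈ Icc 0 T, x t ∈ G.U
  zero : x 0 = y₀
  cont : ContinuousOn x (Icc 0 T)
  deriv : ∀ t ∈ Ioo 0 T, (∀ᶠ u in 𝓝 t, G.choice (b u) = G.choice (b t)) →
    HasDerivAt x (G.choice (b t) t (x t)) t

variable {G} {b b' : ℝ → Fin G.arity → Bool} {y₀ : State G.m} {T T' : ℝ} {x y : ℝ → State G.m}

lemma IsTrajectoryOn.mono (h : G.IsTrajectoryOn b y₀ T x) (hT : T' ≤ T) :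
    G.IsTrajectoryOn b y₀ T' x where
  mem t ht := h.mem t ⟨ht.1, ht.2.trans hT⟩
  zero := h.zero
  cont := h.cont.mono (Icc_subset_Icc_right hT)
  deriv t ht := h.deriv t ⟨ht.1, ht.2.trans_le hT⟩

lemma continuousAt_choice (c : Fin G.arity → Bool) {t : ℝ} (ht : 0 < t) (hx : ContinuousAt x t)
    (hU : x t ∈ G.U) : ContinuousAt (fun u => G.choice c u (x u)) t := by
  have h1 : ContinuousAt (fun p : ℝ × State G.m => G.choice c p.1 p.2) (t, x t) :=
    (G.cont _ (G.choice_mem c)).continuousAt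
      (prod_mem_nhds (Ici_mem_nhds ht) (G.isOpen_U.mem_nhds hU))
  exact ContinuousAt.comp (f := fun u => (u, x u)) h1 (continuousAt_id.prodMk hx)

lemma exists_bound (G : Gate) (T : ℝ) :
    ∃ M : ℝ, ∀ c, ∀ t ∈ Icc 0 T, ∀ x ∈ G.U, ‖G.choice c t x‖ ≤ M := by
  choose M hM using fun c => G.bounded _ (G.choice_mem c) T
  obtain ⟨B, hB⟩ := (Set.finite_range M).bddAbove
  exact ⟨B, fun c t ht x hx => (hM c t ht x hx).trans (hB ⟨c, rfl⟩)⟩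

/-- A trajectory can be prolonged through an interval in which the mode does not change. -/
lemma IsTrajectoryOn.exists_extend (h : G.IsTrajectoryOn b y₀ T x) (hT : 0 ≤ T) (hTT' : T < T')
    {c : Fin G.arity → Bool} (hc : ∀ t ∈ Ioo T T', b t = c) :
    ∃ x', G.IsTrajectoryOn b y₀ T' x' := by
  obtain ⟨y, hy0, hyc, hyU, hyd⟩ :=
    G.stays _ (G.choice_mem c) T T' hT hTT' (x T) (h.mem T ⟨hT, le_rfl⟩)
  set z : ℝ → State G.m := fun t => if t ≤ T then x t else y t with hz
  have hzx : ∀ t, t ≤ T → z t = x t := fun t ht => if_pos ht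
  have hzy : ∀ t, T ≤ t → z t = y t := fun t ht => by
    rcases ht.eq_or_lt with rfl | h'
    · rw [hzx _ le_rfl, hy0]
    · exact if_neg (not_le.2 h')
  have hcont : ContinuousOn z (Icc 0 T') := by
    rw [← Icc_union_Icc_eq_Icc hT hTT'.le]
    exact ContinuousOn.union_of_isClosed (h.cont.congr fun t ht => hzx t ht.2)
      (hyc.congr fun t ht => hzy t ht.1) isClosed_Icc isClosed_Icc
  have hmem : ∀ t ∈ Icc 0 T', z t ∈ G.U := fun t ht => by
    rcases le_total t T with h' | h'
    · rw [hzx t h']; exact h.mem t ⟨ht.1, h'⟩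
    · rw [hzy t h']; exact hyU t ⟨h', ht.2⟩
  have hleft : ∀ t ∈ Ioo 0 T, (∀ᶠ u in 𝓝 t, G.choice (b u) = G.choice (b t)) →
      HasDerivAt z (G.choice (b t) t (z t)) t := fun t ht hb => by
    rw [hzx t ht.2.le]
    refine (h.deriv t ht hb).congr_of_eventuallyEq ?_
    filter_upwards [Iio_mem_nhds ht.2] with u hu using hzx u (le_of_lt hu)
  have hright : ∀ t ∈ Ioo T T', HasDerivAt z (G.choice (b t) t (z t)) t := fun t ht => by
    rw [hzy t ht.1.le, hc t ht]
    refine (hyd t ht).congr_of_eventuallyEq ?_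
    filter_upwards [Ioi_mem_nhds ht.1] with u hu using hzy u (le_of_lt hu)
  refine ⟨z, hmem, by rw [hzx 0 hT, h.zero], hcont, fun t ht hb => ?_⟩
  rcases lt_trichotomy t T with h' | rfl | h'
  · exact hleft t ⟨ht.1, h'⟩ hb
  -- the mode need not jump at the gluing point, in which case `z` must be differentiable there
  · have hct : ContinuousAt z t := hcont.continuousAt (Icc_mem_nhds ht.1 ht.2)
    refine hasDerivAt_of_eventually_hasDerivAt_nhdsNE
      (g := fun u => G.choice (b t) u (z u)) ?_ hct
      (continuousAt_choice _ ht.1 hct (hmem t ⟨hT, hTT'.le⟩))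
    rw [eventually_nhdsWithin_iff]
    filter_upwards [hb.eventually_nhds, Ioo_mem_nhds ht.1 ht.2] with u hu hu0 hne
    have hu' := hu.self_of_nhds
    rw [← hu']
    rcases lt_or_gt_of_ne hne with h' | h'
    · exact hleft u ⟨hu0.1, h'⟩ (hu' ▸ hu)
    · exact hright u ⟨h', hu0.2⟩
  · exact hright t ⟨h', ht.2⟩

lemma exists_isTrajectoryOn (hb : Regulated b) (hy₀ : y₀ ∈ G.U) :
    ∀ T, 0 ≤ T → ∃ x, G.IsTrajectoryOn b y₀ T x := by
  refine forall_nonneg_of_step ⟨fun _ => y₀, fun _ _ => hy₀, rfl, continuousOn_const, ?_⟩ ?_ ?_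
  · simp
  · intro t ht hs
    obtain ⟨c, hc⟩ := hb.left t
    obtain ⟨s, hst, hsc⟩ := exists_Ioo_of_eventually_nhdsLT hc
    obtain ⟨x, hx⟩ := hs (max s 0) (le_max_right _ _) (max_lt hst ht)
    exact hx.exists_extend (le_max_right _ _) (max_lt hst ht)
      fun u hu => hsc u ⟨(le_max_left _ _).trans_lt hu.1, hu.2⟩
  · rintro s hs ⟨x, hx⟩
    obtain ⟨T, hsT, hT⟩ := exists_Ioo_of_eventually_nhdsGT (hb.right s)
    exact ⟨T, hsT, fun t ht => hx.exists_extend hs ht.1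
      fun u hu => hT u ⟨hu.1, hu.2.trans ht.2⟩⟩

/-! ### Stability of trajectories under perturbations of the mode signal -/

open MeasureTheory in
lemma aestronglyMeasurable_choice (hb : Regulated b) (hy : ContinuousOn y (Icc 0 T))
    (hU : ∀ t ∈ Icc 0 T, y t ∈ G.U) :
    AEStronglyMeasurable (fun u => G.choice (b u) u (y u)) (volume.restrict (Ioc 0 T)) := by
  set S := {t | ¬ ∀ᶠ u in 𝓝 t, b u = b t}
  have hS : S.Countable := hb.countable_jumps
  have hae : (Ioo 0 T \ S : Set ℝ) =ᵐ[volume] Ioc 0 T :=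
    (sdiff_null_ae_eq_self (hS.measure_zero _)).trans Ioo_ae_eq_Ioc
  rw [← Measure.restrict_congr_set hae]
  -- off the countable set of jumps, the integrand is continuous
  refine ContinuousOn.aestronglyMeasurable (fun t ht => ?_)
    (measurableSet_Ioo.diff hS.measurableSet)
  have htS : ∀ᶠ u in 𝓝 t, b u = b t := not_not.1 ht.2
  have h1 := continuousAt_choice (b t) ht.1.1 (hy.continuousAt (Icc_mem_nhds ht.1.1 ht.1.2))
    (hU t (Ioo_subset_Icc_self ht.1))
  exact (h1.congr (htS.mono fun u hu => by rw [hu])).continuousWithinAt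

open MeasureTheory in
lemma intervalIntegrable_choice (hT : 0 ≤ T) (hb : Regulated b) (hy : ContinuousOn y (Icc 0 T))
    (hU : ∀ t ∈ Icc 0 T, y t ∈ G.U) :
    IntervalIntegrable (fun u => G.choice (b u) u (y u)) volume 0 T := by
  obtain ⟨M, hM⟩ := G.exists_bound T
  rw [intervalIntegrable_iff_integrableOn_Ioc_of_le hT]
  refine Integrable.of_bound (aestronglyMeasurable_choice hb hy hU) M ?_
  filter_upwards [ae_restrict_mem measurableSet_Ioc] with u hu
  exact hM _ u ⟨hu.1.le, hu.2⟩ _ (hU u ⟨hu.1.le, hu.2⟩)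

lemma IsTrajectoryOn.integral_eq (hx : G.IsTrajectoryOn b y₀ T x) (hT : 0 ≤ T)
    (hb : Regulated b) : ∫ u in (0 : ℝ)..T, G.choice (b u) u (x u) = x T - y₀ := by
  rw [← hx.zero]
  refine MeasureTheory.integral_eq_of_hasDerivAt_off_countable_of_le x _ hT hb.countable_jumps
    hx.cont (fun t ht => hx.deriv t ht.1 ?_) (intervalIntegrable_choice hT hb hx.cont hx.mem)
  have htS : ∀ᶠ u in 𝓝 t, b u = b t := not_not.1 ht.2
  exact htS.mono fun u hu => by rw [hu]

/-- Two mode signals, with the same initial state, lead to trajectories whose distance is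
controlled by the integral of the difference of the two modes along one of them. -/
lemma exists_norm_sub_le (G : Gate) (T : ℝ) : ∃ C : ℝ, ∀ {b b' : ℝ → Fin G.arity → Bool}
    {y₀ : State G.m} {x y : ℝ → State G.m}, Regulated b → Regulated b' →
    G.IsTrajectoryOn b y₀ T x → G.IsTrajectoryOn b' y₀ T y → ∀ t ∈ Icc 0 T,
    ‖x t - y t‖ ≤
      (∫ u in (0 : ℝ)..T, ‖G.choice (b u) u (y u) - G.choice (b' u) u (y u)‖) * C := by
  obtain ⟨K, hK⟩ := G.lipschitz T
  refine ⟨Real.exp (K * T), fun {b b' y₀ x y} hb hb' hx hy t ht => ?_⟩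
  have hT : 0 ≤ T := ht.1.trans ht.2
  set D : ℝ → ℝ := fun u => ‖G.choice (b u) u (y u) - G.choice (b' u) u (y u)‖ with hD
  have hDint : IntervalIntegrable D MeasureTheory.volume 0 T :=
    ((intervalIntegrable_choice hT hb hy.cont hy.mem).sub
      (intervalIntegrable_choice hT hb' hy.cont hy.mem)).norm
  have hE : 0 ≤ ∫ u in (0 : ℝ)..T, D u :=
    intervalIntegral.integral_nonneg hT fun u _ => norm_nonneg _
  have hrc : ContinuousOn (fun u => ‖x u - y u‖) (Icc 0 T) := (hx.cont.sub hy.cont).norm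
  have key := le_mul_exp_of_le_add_integral (r := fun u => ‖x u - y u‖) (K := K)
    (E := ∫ u in (0 : ℝ)..T, D u) hT K.2 hrc (fun _ _ => norm_nonneg _) (fun s hs => ?_) t ht
  · exact key.trans (mul_le_mul_of_nonneg_left
      (Real.exp_le_exp.2 (mul_le_mul_of_nonneg_left ht.2 K.2)) hE)
  have hxs := hx.mono hs.2
  have hys := hy.mono hs.2
  have h1 := intervalIntegrable_choice hs.1 hb hxs.cont hxs.mem
  have h2 := intervalIntegrable_choice hs.1 hb' hys.cont hys.mem
  have hsub : uIcc 0 s ⊆ uIcc 0 T := by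
    rw [uIcc_of_le hs.1, uIcc_of_le hT]; exact Icc_subset_Icc_right hs.2
  have hDs : IntervalIntegrable D MeasureTheory.volume 0 s := hDint.mono_set hsub
  have hrs : IntervalIntegrable (fun u => (K : ℝ) * ‖x u - y u‖) MeasureTheory.volume 0 s :=
    ((hrc.mono (Icc_subset_Icc_right hs.2)).intervalIntegrable_of_Icc hs.1).const_mul _
  calc ‖x s - y s‖ = ‖(x s - y₀) - (y s - y₀)‖ := by rw [sub_sub_sub_cancel_right]
    _ = ‖∫ u in (0 : ℝ)..s, (G.choice (b u) u (x u) - G.choice (b' u) u (y u))‖ := by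
      rw [← hxs.integral_eq hs.1 hb, ← hys.integral_eq hs.1 hb',
        intervalIntegral.integral_sub h1 h2]
    _ ≤ ∫ u in (0 : ℝ)..s, ‖G.choice (b u) u (x u) - G.choice (b' u) u (y u)‖ :=
      intervalIntegral.norm_integral_le_integral_norm hs.1
    _ ≤ ∫ u in (0 : ℝ)..s, (D u + K * ‖x u - y u‖) := by
      refine intervalIntegral.integral_mono_on hs.1 (h1.sub h2).norm (hDs.add hrs) fun u hu => ?_
      have hu' : u ∈ Icc 0 T := ⟨hu.1, hu.2.trans hs.2⟩
      have hl := (hK _ (G.choice_mem (b u)) u hu').norm_sub_le (hx.mem u hu') (hy.mem u hu')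
      have := norm_sub_le_norm_sub_add_norm_sub (G.choice (b u) u (x u))
        (G.choice (b u) u (y u)) (G.choice (b' u) u (y u))
      simp only [hD]; linarith
    _ = (∫ u in (0 : ℝ)..s, D u) + K * ∫ u in (0 : ℝ)..s, ‖x u - y u‖ := by
      rw [intervalIntegral.integral_add hDs hrs, intervalIntegral.integral_const_mul]
    _ ≤ _ := by
      gcongr
      exact intervalIntegral.integral_mono_interval le_rfl hs.1 hs.2
        (Eventually.of_forall fun u => norm_nonneg _) hDint

lemma IsTrajectoryOn.eqOn (hb : Regulated b) (hx : G.IsTrajectoryOn b y₀ T x)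
    (hy : G.IsTrajectoryOn b y₀ T y) : EqOn x y (Icc 0 T) := fun t ht => by
  obtain ⟨C, hC⟩ := G.exists_norm_sub_le T
  simpa [sub_eq_zero] using hC hb hb hx hy t ht

end Gate

/-! ### Existence of gate outputs -/

/-- The right-continuous version of a function with one-sided limits is a signal. -/
lemma exists_signal (w : ℝ → Bool) (i₀ : Bool)
    (hr : ∀ t, 0 ≤ t → ∃ c, ∀ᶠ u in 𝓝[>] t, w u = c)
    (hl : ∀ t, 0 < t → ∃ c, ∀ᶠ u in 𝓝[<] t, w u = c) :
    ∃ s : Signal, s.init = i₀ ∧ ∀ t, 0 ≤ t → ∀ᶠ u in 𝓝[>] t, s.toFun u = w u := by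
  classical
  choose! r hr using hr
  set f : ℝ → Bool := fun t => if t < 0 then i₀ else r t with hf
  have hf0 : ∀ t, 0 ≤ t → f t = r t := fun t ht => if_neg (not_lt.2 ht)
  have hfr : ∀ t, 0 ≤ t → ∀ c, (∀ᶠ u in 𝓝 t, w u = c) → f t = c := fun t ht c hc => by
    obtain ⟨u, hu, hu'⟩ := ((hr t ht).and (hc.filter_mono nhdsWithin_le_nhds)).exists
    rw [hf0 t ht, ← hu, hu']
  have hright : ∀ t, 0 ≤ t → ∀ᶠ u in 𝓝[>] t, f u = r t ∧ w u = r t := fun t ht => by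
    filter_upwards [eventually_nhdsGT_eventually_nhds (hr t ht), self_mem_nhdsWithin] with u hu hut
    exact ⟨hfr u (ht.trans (le_of_lt hut)) _ hu, hu.self_of_nhds⟩
  refine ⟨⟨f, i₀, fun t ht => if_pos ht, fun t ht => ?_, fun t ht => ?_⟩, rfl, fun t ht => ?_⟩
  · filter_upwards [hright t ht] with u hu
    rw [hu.1, hf0 t ht]
  · obtain ⟨c, hc⟩ := hl t ht
    refine ⟨c, ?_⟩
    filter_upwards [eventually_nhdsLT_eventually_nhds hc, Ioo_mem_nhdsLT ht] with u hu hut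
    exact hfr u hut.1.le _ hu
  · filter_upwards [hright t ht] with u hu
    rw [hu.1, hu.2]

namespace Gate

variable {G : Gate} {b : ℝ → Fin G.arity → Bool} {y₀ : State G.m} {T : ℝ} {x : ℝ → State G.m}

lemma continuous_coord {m : ℕ} : Continuous fun v : State m => v 0 :=
  PiLp.continuous_apply 2 _ 0

lemma continuousOn_coord {A : Set ℝ} (hx : ContinuousOn x A) :
    ContinuousOn (fun u => x u 0) A :=
  continuous_coord.comp_continuousOn hx

/-- On an interval with a constant mode, the analog output has finitely many local extrema. -/
lemma IsTrajectoryOn.finite_extr (hx : G.IsTrajectoryOn b y₀ T x) {s s' : ℝ} (hs : 0 ≤ s)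
    (hss : s < s') (hsT : s' ≤ T) {c : Fin G.arity → Bool} (hc : ∀ u ∈ Ioo s s', b u = c) :
    {t ∈ Ioo s s' | IsLocalExtr (fun u => x u 0) t}.Finite := by
  refine G.finite_optima _ (G.choice_mem c) s s' hs hss x
    ⟨hx.cont.mono (Icc_subset_Icc hs hsT), fun t ht => hx.mem t ⟨hs.trans ht.1, ht.2.trans hsT⟩,
      fun t ht => ?_⟩
  have h := hx.deriv t ⟨hs.trans_lt ht.1, ht.2.trans_le hsT⟩ (by
    filter_upwards [Ioo_mem_nhds ht.1 ht.2] with u hu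
    rw [hc u hu, hc t ht])
  rwa [hc t ht] at h

lemma IsTrajectoryOn.eventually_ne_nhdsGT (hx : G.IsTrajectoryOn b y₀ T x) (hb : Regulated b)
    (ξ : ℝ) {t : ℝ} (ht : 0 ≤ t) (htT : t < T) : ∀ᶠ u in 𝓝[>] t, x u 0 ≠ ξ := by
  obtain ⟨s, hts, hs⟩ := exists_Ioo_of_eventually_nhdsGT (hb.right t)
  have h : t < min s T := lt_min hts htT
  exact eventually_ne_nhdsGT_of_finite_extr h
    (continuousOn_coord (hx.cont.mono (Icc_subset_Icc ht (min_le_right _ _))))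
    (hx.finite_extr ht h (min_le_right _ _)
      fun u hu => hs u ⟨hu.1, hu.2.trans_le (min_le_left _ _)⟩)

lemma IsTrajectoryOn.eventually_ne_nhdsLT (hx : G.IsTrajectoryOn b y₀ T x) (hb : Regulated b)
    (ξ : ℝ) {t : ℝ} (ht : 0 < t) (htT : t ≤ T) : ∀ᶠ u in 𝓝[<] t, x u 0 ≠ ξ := by
  obtain ⟨c, hc⟩ := hb.left t
  obtain ⟨s, hst, hs⟩ := exists_Ioo_of_eventually_nhdsLT hc
  have h : max s 0 < t := max_lt hst ht
  exact eventually_ne_nhdsLT_of_finite_extr h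
    (continuousOn_coord (hx.cont.mono (Icc_subset_Icc (le_max_right _ _) htT)))
    (hx.finite_extr (le_max_right _ _) h htT
      fun u hu => hs u ⟨(le_max_left _ _).trans_lt hu.1, hu.2⟩)

variable {i : Fin G.arity → Signal}

lemma isTrajectoryOn_of_isMatchingOutput
    (hx : IsMatchingOutput (G.modeSwitch i) G.U y₀ x) (T : ℝ) :
    G.IsTrajectoryOn (G.delayedInputs i) y₀ T x where
  mem t ht := hx.1 t ht.1
  zero := hx.2.1
  cont := hx.2.2.1.mono Icc_subset_Ici_self
  deriv t ht h := hx.2.2.2 t ht.1 h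

lemma exists_isMatchingOutput (i : Fin G.arity → Signal) (hy₀ : y₀ ∈ G.U) :
    ∃ x, IsMatchingOutput (G.modeSwitch i) G.U y₀ x := by
  have hb := G.regulated_delayedInputs i
  choose! z hz using exists_isTrajectoryOn hb hy₀
  -- the trajectories on `[0, T]` agree by uniqueness, and are glued together along the diagonal
  have hagree : ∀ T, ∀ t ∈ Icc 0 T, z (t + 1) t = z T t := fun T t ht => by
    have h0 := ht.1
    rcases le_total T (t + 1) with h | h
    · exact ((hz (t + 1) (by linarith)).mono h).eqOn hb (hz T (by linarith [ht.2])) ht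
    · exact (hz (t + 1) (by linarith)).eqOn hb ((hz T (by linarith)).mono h) ⟨h0, by linarith⟩
  have hnear : ∀ t, 0 ≤ t → ∀ u ∈ Icc 0 (t + 1), z (u + 1) u = z (t + 1) u :=
    fun t ht u hu => hagree _ u hu
  refine ⟨fun t => z (t + 1) t, fun t ht => (hz (t + 1) (by linarith)).mem t ⟨ht, by linarith⟩,
    ?_, fun t ht => ?_, fun t ht h => ?_⟩
  · exact (hz _ (by norm_num)).zero
  · have ht' : (0 : ℝ) ≤ t := ht
    have h1 := (hz (t + 1) (by linarith)).cont t ⟨ht', by linarith⟩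
    have h2 : ContinuousWithinAt (z (t + 1)) (Ici 0) t :=
      h1.mono_of_mem_nhdsWithin (by
        rw [← Ici_inter_Iic]
        exact inter_mem_nhdsWithin _ (Iic_mem_nhds (by linarith)))
    refine h2.congr_of_eventuallyEq ?_ rfl
    filter_upwards [inter_mem_nhdsWithin (Ici 0) (Iic_mem_nhds (show t < t + 1 by linarith))]
      with u hu using hnear t ht' u hu
  · have h1 := (hz (t + 1) (by linarith)).deriv t ⟨ht, by linarith⟩ h
    refine h1.congr_of_eventuallyEq ?_
    filter_upwards [Icc_mem_nhds ht (show t < t + 1 by linarith)] with u hu using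
      hnear t ht.le u hu

lemma exists_isOutput (G : Gate) (i : Fin G.arity → Signal) : ∃ o, G.IsOutput i o := by
  obtain ⟨x, hx⟩ := exists_isMatchingOutput i (G.x₀_mem fun j => (i j).init)
  have hb := G.regulated_delayedInputs i
  have hc : ∀ {A : Set ℝ}, A ⊆ Ici 0 → ContinuousOn (fun u => x u 0) A := fun hA =>
    continuousOn_coord (hx.2.2.1.mono hA)
  obtain ⟨o, ho, ho'⟩ := exists_signal (fun t => threshold G.ξ (x t 0)) (threshold G.ξ (x 0 0))
    (fun t ht => by
      obtain ⟨s, hts, hs⟩ := exists_Ioo_of_eventually_nhdsGT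
        ((isTrajectoryOn_of_isMatchingOutput hx (t + 1)).eventually_ne_nhdsGT hb G.ξ ht
          (by linarith))
      obtain ⟨c, hc⟩ := exists_threshold_eq_of_ne
        (hc fun u hu => ht.trans (le_of_lt hu.1)) hs
      exact ⟨c, by filter_upwards [Ioo_mem_nhdsGT hts] with u hu using hc u hu⟩)
    (fun t ht => by
      obtain ⟨s, hst, hs⟩ := exists_Ioo_of_eventually_nhdsLT
        ((isTrajectoryOn_of_isMatchingOutput hx t).eventually_ne_nhdsLT hb G.ξ ht le_rfl)
      have h : max s 0 < t := max_lt hst ht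
      obtain ⟨c, hc⟩ := exists_threshold_eq_of_ne
        (hc fun u (hu : u ∈ Ioo (max s 0) t) => (le_max_right s 0).trans (le_of_lt hu.1))
        fun u hu => hs u ⟨(le_max_left _ _).trans_lt hu.1, hu.2⟩
      exact ⟨c, by filter_upwards [Ioo_mem_nhdsLT h] with u hu using hc u hu⟩)
  exact ⟨o, x, hx, ho, ho'⟩

/-! ### Continuity of gates -/

/-- A gate output agrees with the thresholded trajectory wherever the latter is not at the
threshold. -/
lemma output_eq_threshold (hx : IsMatchingOutput (G.modeSwitch i) G.U y₀ x) {o : Signal}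
    (ho : ∀ t, 0 ≤ t → ∀ᶠ u in 𝓝[>] t, o.toFun u = threshold G.ξ (x u 0)) {t : ℝ} (ht : 0 < t)
    (hne : x t 0 ≠ G.ξ) : o.toFun t = threshold G.ξ (x t 0) := by
  have hc : ContinuousAt (fun u => x u 0) t :=
    (continuousOn_coord hx.2.2.1).continuousAt (Ici_mem_nhds ht)
  obtain ⟨u, h1, h2, h3⟩ := ((o.right_cont t ht.le).and ((ho t ht.le).and
    ((eventually_threshold_eq hc hne).filter_mono nhdsWithin_le_nhds))).exists
  rw [← h1, h2, h3.2]

/-- The analog output meets a given level at countably many times only; in particular it is not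
constant on any interval. -/
lemma countable_level (hx : IsMatchingOutput (G.modeSwitch i) G.U y₀ x) (ξ : ℝ) :
    {t | 0 < t ∧ x t 0 = ξ}.Countable := by
  refine countable_of_eventually_nhdsGT_notMem fun t ht => ?_
  filter_upwards [(isTrajectoryOn_of_isMatchingOutput hx (t + 1)).eventually_ne_nhdsGT
    (G.regulated_delayedInputs i) ξ ht.1.le (by linarith)] with u hu h using hu h.2

open MeasureTheory in
/-- Trajectories depend continuously on the mode signal. -/
lemma tendsto_trajectory {κ : Type*} {l : Filter κ} [l.IsCountablyGenerated]
    {bk : κ → ℝ → Fin G.arity → Bool} {xk : κ → ℝ → State G.m} (hb : Regulated b)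
    (hbk : ∀ k, Regulated (bk k)) (hx : G.IsTrajectoryOn b y₀ T x)
    (hxk : ∀ k, G.IsTrajectoryOn (bk k) y₀ T (xk k))
    (hconv : ∀ᵐ t, t < T → ∀ᶠ k in l, bk k t = b t) {t : ℝ} (ht : t ∈ Icc 0 T) :
    Tendsto (fun k => xk k t) l (𝓝 (x t)) := by
  have hT : 0 ≤ T := ht.1.trans ht.2
  obtain ⟨C, hC⟩ := G.exists_norm_sub_le T
  obtain ⟨M, hM⟩ := G.exists_bound T
  have hlim : Tendsto (fun k => ∫ u in (0 : ℝ)..T,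
      ‖G.choice (bk k u) u (x u) - G.choice (b u) u (x u)‖) l
      (𝓝 (∫ u in (0 : ℝ)..T, (0 : ℝ))) := by
    refine intervalIntegral.tendsto_integral_filter_of_dominated_convergence (fun _ => M + M)
      (Eventually.of_forall fun k => ?_) (Eventually.of_forall fun k => ?_)
      intervalIntegrable_const ?_
    · rw [uIoc_of_le hT]
      exact ((aestronglyMeasurable_choice (hbk k) hx.cont hx.mem).sub
        (aestronglyMeasurable_choice hb hx.cont hx.mem)).norm
    · refine Eventually.of_forall fun u hu => ?_
      rw [uIoc_of_le hT] at hu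
      have hu' : u ∈ Icc 0 T := ⟨hu.1.le, hu.2⟩
      rw [norm_norm]
      exact (norm_sub_le _ _).trans
        (add_le_add (hM _ u hu' _ (hx.mem u hu')) (hM _ u hu' _ (hx.mem u hu')))
    · filter_upwards [hconv, measure_eq_zero_iff_ae_notMem.1 (measure_singleton T)]
        with u hu huT hu'
      rw [uIoc_of_le hT] at hu'
      refine tendsto_nhds_of_eventually_eq ?_
      filter_upwards [hu (lt_of_le_of_ne hu'.2 huT)] with k hk
      simp [hk]
  rw [intervalIntegral.integral_zero] at hlim
  rw [tendsto_iff_norm_sub_tendsto_zero]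
  refine squeeze_zero (fun _ => norm_nonneg _) (fun k => hC (hbk k) hb (hxk k) hx t ht) ?_
  simpa using hlim.mul_const C

open MeasureTheory in
/-- Gates are continuous with respect to convergence of signals at almost every time, and they
delay the effect of their inputs. -/
lemma ae_eventually_output_eq {κ : Type*} {l : Filter κ} [l.IsCountablyGenerated]
    {ik : κ → Fin G.arity → Signal} {ok : κ → Signal} {o : Signal} {δ : ℝ}
    (hδ : ∀ j, δ ≤ G.delay j) (hinit : ∀ k j, (ik k j).init = (i j).init)
    (ho : G.IsOutput i o) (hok : ∀ k, G.IsOutput (ik k) (ok k))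
    (hconv : ∀ j, ∀ᵐ t, t < T → ∀ᶠ k in l, (ik k j).toFun t = (i j).toFun t) :
    ∀ᵐ t, t < T + δ → ∀ᶠ k in l, (ok k).toFun t = o.toFun t := by
  obtain ⟨x, hx, hx0, hxo⟩ := ho
  choose xk hxk hxk0 hxko using hok
  have hinit' : ∀ k, (fun j => (ik k j).init) = fun j => (i j).init := fun k => funext (hinit k)
  have hmode : ∀ᵐ t, t < T + δ → ∀ᶠ k in l, G.delayedInputs (ik k) t = G.delayedInputs i t := by
    have : ∀ j, ∀ᵐ t, t - G.delay j < T →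
        ∀ᶠ k in l, (ik k j).toFun (t - G.delay j) = (i j).toFun (t - G.delay j) := fun j =>
      (measurePreserving_sub_right volume (G.delay j)).quasiMeasurePreserving.ae (hconv j)
    filter_upwards [ae_all_iff.2 this] with t ht htT
    filter_upwards [eventually_all.2 fun j => ht j (by linarith [hδ j])] with k hk
    funext j
    simpa only [delayedInputs, Signal.delayed_eq] using hk j
  have htraj : ∀ t ∈ Icc 0 (T + δ), Tendsto (fun k => xk k t) l (𝓝 (x t)) := fun t ht =>
    tendsto_trajectory (G.regulated_delayedInputs i) (fun k => G.regulated_delayedInputs (ik k))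
      (isTrajectoryOn_of_isMatchingOutput hx _)
      (fun k => hinit' k ▸ isTrajectoryOn_of_isMatchingOutput (hxk k) _) hmode ht
  filter_upwards [measure_eq_zero_iff_ae_notMem.1 ((countable_level hx G.ξ).measure_zero volume),
    measure_eq_zero_iff_ae_notMem.1 (measure_singleton (0 : ℝ))] with t ht ht0 htT
  rcases lt_or_gt_of_ne (show t ≠ 0 from ht0) with h | h
  · refine Eventually.of_forall fun k => ?_
    rw [(ok k).eq_init t h, o.eq_init t h, hxk0, hx0, (hxk k).2.1, hx.2.1, hinit' k]
  · have hne : x t 0 ≠ G.ξ := fun hh => ht ⟨h, hh⟩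
    have hlim : Tendsto (fun k => xk k t 0) l (𝓝 (x t 0)) :=
      (continuous_coord.tendsto _).comp (htraj t ⟨h.le, htT.le⟩)
    filter_upwards [eventually_threshold_eq hlim hne] with k hk
    rw [output_eq_threshold (hxk k) (hxko k) h hk.1, output_eq_threshold hx hxo h hne, hk.2]

end Gate

/-! ### Transitions of signals -/

namespace Signal

variable {s s' : Signal} {t T₀ Δ : ℝ}

lemma ext_of_toFun (h₀ : s.init = s'.init) (h : ∀ t, s.toFun t = s'.toFun t) : s = s' := by
  cases s; cases s'
  obtain rfl : _ = _ := h₀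
  obtain rfl : _ = _ := funext h
  rfl

/-- By right-continuity, signals that agree almost everywhere before `T` agree everywhere
before `T`. -/
lemma eq_of_ae_eq {T : ℝ} (h : ∀ᵐ t, t < T → s.toFun t = s'.toFun t) (ht : t < T) :
    s.toFun t = s'.toFun t := by
  obtain ⟨r, htr, hr⟩ := exists_Ioo_of_eventually_nhdsGT ((s.regulated.right t).and
    ((s'.regulated.right t).and (Ioo_mem_nhdsGT ht)))
  obtain ⟨u, hu, hur⟩ := (MeasureTheory.Measure.dense_of_ae h).exists_between htr
  obtain ⟨h1, h2, h3⟩ := hr u hur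
  rw [← h1, ← h2]
  exact hu h3.2

lemma eventually_eq_of_not_transition (h : ¬ s.Transition t) :
    ∀ᶠ u in 𝓝 t, s.toFun u = s.toFun t := by
  obtain ⟨c, hc⟩ := s.regulated.left t
  have hct : c = s.toFun t := by
    by_contra hne
    cases c
    · exact h (Or.inl ⟨hc, by simpa using Ne.symm hne⟩)
    · exact h (Or.inr ⟨hc, by simpa using Ne.symm hne⟩)
  subst hct
  have hlr : ∀ᶠ u in 𝓝[≠] t, s.toFun u = s.toFun t := by
    rw [← Iio_union_Ioi, nhdsWithin_union]
    exact eventually_sup.2 ⟨hc, s.regulated.right t⟩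
  filter_upwards [eventually_nhdsWithin_iff.1 hlr] with u hu
  by_cases hut : u = t
  · rw [hut]
  · exact hu hut

lemma not_transition_of_eventually_eq {c : Bool} (h : ∀ᶠ u in 𝓝 t, s.toFun u = c) :
    ¬ s.Transition t := by
  have hl : ∀ᶠ u in 𝓝[<] t, s.toFun u = c := h.filter_mono nhdsWithin_le_nhds
  have ht := h.self_of_nhds
  rintro (⟨h1, h2⟩ | ⟨h1, h2⟩) <;> obtain ⟨u, hu, hu'⟩ := (hl.and h1).exists <;> simp_all

/-- A signal is constant on an interval without transitions; a transition at the left end point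
is harmless. -/
lemma eq_of_not_transition {A : Set ℝ} (hA : IsPreconnected A)
    (h : ∀ u ∈ A, ¬ s.Transition u ∨ A ⊆ Ici u) {u v : ℝ} (hu : u ∈ A) (hv : v ∈ A) :
    s.toFun u = s.toFun v := by
  refine hA.constant (fun w hw => tendsto_nhds_of_eventually_eq ?_) hu hv
  rcases h w hw with h' | h'
  · exact nhdsWithin_le_nhds (eventually_eq_of_not_transition h')
  · refine nhdsWithin_mono _ h' ?_
    rw [← Ioi_insert, nhdsWithin_insert]
    exact ⟨rfl, s.regulated.right w⟩

/-- The zero signal is the signal that vanishes identically. -/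
lemma isZero_iff : s.IsZero ↔ s.init = false ∧ ∀ t, s.toFun t = false := by
  refine ⟨fun h => ⟨h.1, fun t => ?_⟩, fun h => ⟨h.1, fun t =>
    not_transition_of_eventually_eq (Eventually.of_forall h.2)⟩⟩
  rw [eq_of_not_transition isPreconnected_univ (fun u _ => Or.inl (h.2 u)) (mem_univ t)
    (mem_univ (-1)), s.eq_init _ (by norm_num), h.1]

lemma Rising.nonneg (h : s.Rising t) (h₀ : s.init = false) : 0 ≤ t := by
  by_contra! ht
  have := h.2
  rw [s.eq_init t ht, h₀] at this
  cases this

lemma IsPulse.toFun_eq (h : s.IsPulse T₀ Δ) (t : ℝ) :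
    s.toFun t = decide (T₀ ≤ t ∧ t < T₀ + Δ) := by
  obtain ⟨h₀, ⟨hΔ, hr, hf, -⟩, htr⟩ := h
  rcases lt_or_ge t T₀ with h1 | h1
  · have : s.toFun t = s.toFun (min t (-1)) :=
      eq_of_not_transition isPreconnected_Iio (A := Iio T₀)
        (fun u (hu : u < T₀) => Or.inl fun hu' => by rcases htr u hu' with h | h <;> linarith)
        h1 ((min_le_left _ _).trans_lt h1)
    rw [this, s.eq_init _ ((min_le_right _ _).trans_lt (by norm_num)), h₀]
    simp [h1]
  rcases lt_or_ge t (T₀ + Δ) with h2 | h2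
  · have : s.toFun t = s.toFun T₀ :=
      eq_of_not_transition isPreconnected_Ico (A := Ico T₀ (T₀ + Δ)) (fun u hu => by
        rcases hu.1.eq_or_lt with h | h
        · exact Or.inr fun v hv => h ▸ hv.1
        · refine Or.inl fun hu' => ?_
          have := hu.2
          rcases htr u hu' with h | h <;> linarith) ⟨h1, h2⟩ ⟨le_rfl, by linarith⟩
    rw [this, hr.2]
    simp [h1, h2]
  · have : s.toFun t = s.toFun (T₀ + Δ) :=
      eq_of_not_transition isPreconnected_Ici (A := Ici (T₀ + Δ)) (fun u hu => by
        rcases (mem_Ici.1 hu).eq_or_lt with h | h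
        · exact Or.inr fun v hv => h ▸ hv
        · exact Or.inl fun hu' => by rcases htr u hu' with h | h <;> linarith) h2 self_mem_Ici
    rw [this, hf.2]
    simp [h2]

lemma isPulse_of_toFun_eq (hΔ : 0 < Δ) (h₀ : s.init = false)
    (h : ∀ t, s.toFun t = decide (T₀ ≤ t ∧ t < T₀ + Δ)) : s.IsPulse T₀ Δ := by
  have htr : ∀ t, s.Transition t → t = T₀ ∨ t = T₀ + Δ := fun t ht => by
    by_contra! hne
    rcases lt_or_gt_of_ne hne.1 with h1 | h1
    · refine not_transition_of_eventually_eq (c := false) ?_ ht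
      filter_upwards [Iio_mem_nhds h1] with u hu
      simp [h, not_le.2 (show u < T₀ from hu)]
    rcases lt_or_gt_of_ne hne.2 with h2 | h2
    · refine not_transition_of_eventually_eq (c := true) ?_ ht
      filter_upwards [Ioo_mem_nhds h1 h2] with u hu
      simp [h, hu.1.le, hu.2]
    · refine not_transition_of_eventually_eq (c := false) ?_ ht
      filter_upwards [Ioi_mem_nhds h2] with u hu
      simp [h, le_of_lt (show T₀ + Δ < u from hu)]
  refine ⟨h₀, ⟨hΔ, ⟨?_, by simp [h, hΔ]⟩, ⟨?_, by simp [h]⟩, fun t ht ht' => ?_⟩, htr⟩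
  · filter_upwards [self_mem_nhdsWithin] with u hu
    simp [h, not_le.2 (show u < T₀ from hu)]
  · filter_upwards [Ioo_mem_nhdsLT (show T₀ < T₀ + Δ by linarith)] with u hu
    simp [h, hu.1.le, hu.2]
  · rcases htr t ht' with h | h
    · exact ht.1.ne' h
    · exact ht.2.ne h

/-- The pulse of length `Δ` at time `T₀`; it degenerates to the zero signal for `Δ = 0`. -/
noncomputable def pulse (T₀ Δ : ℝ) (hT₀ : 0 ≤ T₀) : Signal where
  toFun t := decide (T₀ ≤ t ∧ t < T₀ + Δ)
  init := false
  eq_init t ht := by simp [not_le.2 (ht.trans_le hT₀)]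
  right_cont t _ := by
    rcases lt_or_ge t T₀ with h1 | h1
    · filter_upwards [Ioo_mem_nhdsGT h1] with u hu
      simp [not_le.2 h1, not_le.2 hu.2]
    rcases lt_or_ge t (T₀ + Δ) with h2 | h2
    · filter_upwards [Ioo_mem_nhdsGT h2] with u hu
      simp [h1, h2, hu.2, h1.trans hu.1.le]
    · filter_upwards [self_mem_nhdsWithin] with u hu
      simp [not_lt.2 h2, not_lt.2 (h2.trans (le_of_lt (show t < u from hu)))]
  left_lim t _ := by
    rcases le_or_gt t T₀ with h1 | h1
    · refine ⟨false, ?_⟩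
      filter_upwards [self_mem_nhdsWithin] with u hu
      simp [not_le.2 ((show u < t from hu).trans_le h1)]
    rcases le_or_gt t (T₀ + Δ) with h2 | h2
    · refine ⟨true, ?_⟩
      filter_upwards [Ioo_mem_nhdsLT h1] with u hu
      simp [hu.1.le, hu.2.trans_le h2]
    · refine ⟨false, ?_⟩
      filter_upwards [Ioo_mem_nhdsLT h2] with u hu
      simp [hu.1.le]

/-- If there were no rising transition, the value `0` would propagate from negative times. -/
lemma exists_rising (h₀ : s.init = false) (ht : s.toFun t = true) : ∃ t₀, s.Rising t₀ := by
  by_contra! hno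
  have hfalse : ∀ t, (∀ᶠ u in 𝓝[<] t, s.toFun u = false) → s.toFun t = false := fun t hl => by
    by_contra h
    exact hno t ⟨hl, by simpa using h⟩
  have hneg : ∀ u < 0, s.toFun u = false := fun u hu => (s.eq_init u hu).trans h₀
  have hall : ∀ t, 0 ≤ t → ∀ u ≤ t, s.toFun u = false := by
    refine forall_nonneg_of_step (fun u hu => ?_) (fun t ht hs u hu => ?_) (fun r hr hs => ?_)
    · rcases hu.eq_or_lt with rfl | hu
      · exact hfalse 0 (by filter_upwards [self_mem_nhdsWithin] with u hu using hneg u hu)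
      · exact hneg u hu
    · have hlt : ∀ u < t, s.toFun u = false := fun u hu =>
        hs (max u 0) (le_max_right _ _) (max_lt hu ht) u (le_max_left _ _)
      rcases hu.eq_or_lt with rfl | hu
      · exact hfalse u (by filter_upwards [self_mem_nhdsWithin] with v hv using hlt v hv)
      · exact hlt u hu
    · obtain ⟨T, hT, hrT⟩ := exists_Ioo_of_eventually_nhdsGT (s.right_cont r hr)
      refine ⟨T, hT, fun t ht u hu => ?_⟩
      rcases le_or_gt u r with h | h
      · exact hs u h
      · rw [hrT u ⟨h, hu.trans_lt ht.2⟩, hs r le_rfl]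
  have := hall (max t 0) (le_max_right _ _) t (le_max_left _ _)
  simp [ht] at this

/-- After a rising transition, a signal stays `1` for as long as it contains no short pulse. -/
lemma Rising.eq_true {ε t₀ : ℝ} (h : s.Rising t₀) (hp : ∀ l, s.ContainsPulse t₀ l → ε < l)
    {u : ℝ} (hu : u ∈ Icc t₀ (t₀ + ε)) : s.toFun u = true := by
  by_contra hne
  have hut : t₀ < u := lt_of_le_of_ne hu.1 fun hh => hne (hh ▸ h.2)
  set B : Set ℝ := {v | t₀ < v ∧ s.toFun v = false}
  have hB : u ∈ B := ⟨hut, by simpa using hne⟩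
  have hbdd : BddBelow B := ⟨t₀, fun v hv => hv.1.le⟩
  obtain ⟨r, hr, hr'⟩ := exists_Ioo_of_eventually_nhdsGT (s.regulated.right t₀)
  have hlt : t₀ < sInf B := hr.trans_le <| le_csInf ⟨u, hB⟩ fun v hv => by
    by_contra! hvr
    have := hr' v ⟨hv.1, hvr⟩
    rw [hv.2, h.2] at this
    cases this
  have htrue : ∀ v ∈ Ioo t₀ (sInf B), s.toFun v = true := fun v hv => by
    by_contra hv'
    exact absurd (csInf_le hbdd (show v ∈ B from ⟨hv.1, by simpa using hv'⟩)) (not_le.2 hv.2)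
  have hfalse : s.toFun (sInf B) = false := by
    by_contra hv
    obtain ⟨w, hw, hw'⟩ := exists_Ioo_of_eventually_nhdsGT (s.regulated.right (sInf B))
    obtain ⟨v, hvB, hvw⟩ := exists_lt_of_csInf_lt ⟨u, hB⟩ hw
    rcases (csInf_le hbdd hvB).eq_or_lt with h1 | h1
    · exact hv (h1 ▸ hvB.2)
    · exact hv ((hw' v ⟨h1, hvw⟩).symm.trans hvB.2)
  have := hp (sInf B - t₀) ⟨sub_pos.2 hlt, h, by
    rw [add_sub_cancel]
    exact ⟨by filter_upwards [Ioo_mem_nhdsLT hlt] with v hv using htrue v hv, hfalse⟩,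
    fun t ht => by
      rw [add_sub_cancel] at ht
      refine not_transition_of_eventually_eq (c := true) ?_
      filter_upwards [Ioo_mem_nhds ht.1 ht.2] with v hv using htrue v hv⟩
  have := csInf_le hbdd hB
  linarith [hu.2]

/-- A sequence of signals that stabilizes on `(-∞, n * δ)` from index `n` on has a limit. -/
lemma exists_limit (s : ℕ → Signal) {δ : ℝ} (hδ : 0 < δ) {i₀ : Bool}
    (hinit : ∀ n, (s n).init = i₀)
    (h : ∀ n : ℕ, ∀ t < n * δ, (s (n + 1)).toFun t = (s n).toFun t) :
    ∃ S : Signal, S.init = i₀ ∧ ∀ n : ℕ, ∀ t < n * δ, S.toFun t = (s n).toFun t := by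
  have hle : ∀ n m : ℕ, n ≤ m → ∀ t < n * δ, (s m).toFun t = (s n).toFun t := fun n m hnm t ht => by
    induction m, hnm using Nat.le_induction with
    | base => rfl
    | succ m hm ih =>
      have : (n : ℝ) ≤ m := by exact_mod_cast hm
      rw [h m t (ht.trans_le (by gcongr)), ih]
  set N : ℝ → ℕ := fun t => ⌊t / δ⌋₊ + 1
  have hN : ∀ t, t < N t * δ := fun t => by
    have := Nat.lt_floor_add_one (t / δ)
    rw [div_lt_iff₀ hδ] at this
    simpa [N] using this
  have hf : ∀ n : ℕ, ∀ t < n * δ, (s (N t)).toFun t = (s n).toFun t := fun n t ht => by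
    rcases le_total n (N t) with h1 | h1
    · exact hle _ _ h1 t ht
    · exact (hle _ _ h1 t (hN t)).symm
  have hnear : ∀ t, ∀ᶠ u in 𝓝 t, (s (N u)).toFun u = (s (N t)).toFun u := fun t => by
    filter_upwards [Iio_mem_nhds (hN t)] with u hu using hf _ u hu
  refine ⟨⟨fun t => (s (N t)).toFun t, i₀, fun t ht => ?_, fun t ht => ?_, fun t ht => ?_⟩, rfl, hf⟩
  · rw [(s _).eq_init t ht, hinit]
  · filter_upwards [nhdsWithin_le_nhds (hnear t), (s (N t)).right_cont t ht] with u h1 h2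
    rw [h1, h2]
  · obtain ⟨c, hc⟩ := (s (N t)).left_lim t ht
    refine ⟨c, ?_⟩
    filter_upwards [nhdsWithin_le_nhds (hnear t), hc] with u h1 h2
    rw [h1, h2]

end Signal

/-! ### Executions of strictly causal circuits -/

/-- Gates are causal: the output up to time `T + δ` depends on the inputs before time `T` only. -/
lemma Gate.IsOutput.eq_of_lt {G : Gate} {i i' : Fin G.arity → Signal} {o o' : Signal} {T δ : ℝ}
    (ho : G.IsOutput i o) (ho' : G.IsOutput i' o') (hδ : ∀ j, δ ≤ G.delay j)
    (hinit : ∀ j, (i j).init = (i' j).init) (h : ∀ j, ∀ t < T, (i j).toFun t = (i' j).toFun t) :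
    ∀ t < T + δ, o.toFun t = o'.toFun t := by
  have := Gate.ae_eventually_output_eq (l := pure ()) (ik := fun _ => i) (ok := fun _ => o) hδ
    (fun _ => hinit) ho' (fun _ => ho)
    (fun j => Eventually.of_forall fun t ht => eventually_pure.2 (h j t ht))
  exact fun t ht => Signal.eq_of_ae_eq (by simpa only [eventually_pure] using this) ht

lemma Gate.IsOutput.init_eq {G : Gate} {i : Fin G.arity → Signal}
    {o : Signal} (h : G.IsOutput i o) : o.init = threshold G.ξ (G.x₀ (fun j => (i j).init) 0) := by
  obtain ⟨x, hx, hx0, -⟩ := h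
  rw [hx0, hx.2.1]

namespace Circuit

variable {C : Circuit}

lemma StrictlyCausal.exists_pos_le_delay (hC : C.StrictlyCausal) :
    ∃ δ : ℝ, 0 < δ ∧ ∀ g j, δ ≤ (C.gate g).delay j := by
  have := C.finite_node
  have h : ∀ᶠ δ : ℝ in 𝓝[>] 0, ∀ g j, δ ≤ (C.gate g).delay j :=
    eventually_all.2 fun g => eventually_all.2 fun j =>
      nhdsWithin_le_nhds (Iic_mem_nhds (hC g j))
  obtain ⟨δ, h1, h2⟩ := (h.and self_mem_nhdsWithin).exists
  exact ⟨δ, h2, h1⟩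

/-- Initial values of the gates that are consistent with the initial values `p` of the input
ports. -/
def IsConsistentInit (C : Circuit) (p : C.InPort → Bool) (ν : C.Node → Bool) : Prop :=
  ∀ g, ν g = threshold (C.gate g).ξ ((C.gate g).x₀ (fun j => Sum.elim p ν (C.src g j)) 0)

lemma init_elim (C : Circuit) (inp : C.InPort → Signal) (s : C.Node → Signal)
    (v : C.InPort ⊕ C.Node) : (Sum.elim inp s v).init =
      Sum.elim (fun p => (inp p).init) (fun g => (s g).init) v := by
  cases v <;> rfl

lemma Execution.isConsistentInit (e : C.Execution) :
    C.IsConsistentInit (fun p => (e.inp p).init) fun g => (e.node g).init := fun g => by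
  simpa only [init_elim] using (e.gate_out g).init_eq

/-- The gate map of the circuit has a fixed point with the prescribed initial values: every
application of the map makes the signals correct for one more minimal delay. -/
lemma exists_execution (hC : C.StrictlyCausal) (inp : C.InPort → Signal) {ν : C.Node → Bool}
    (hν : C.IsConsistentInit (fun p => (inp p).init) ν) :
    ∃ e : C.Execution, e.inp = inp ∧ ∀ g, (e.node g).init = ν g := by
  obtain ⟨δ, hδ, hδ'⟩ := hC.exists_pos_le_delay
  choose Φ hΦ using fun (s : C.Node → Signal) g =>
    (C.gate g).exists_isOutput fun j => Sum.elim inp s (C.src g j)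
  have hΦinit : ∀ s : C.Node → Signal, (∀ g, (s g).init = ν g) → ∀ g, (Φ s g).init = ν g :=
    fun s hs g => by
      rw [(hΦ s g).init_eq, hν g]
      simp only [init_elim, hs]
  have hΦcausal : ∀ (s s' : C.Node → Signal) (T : ℝ), (∀ g, (s g).init = ν g) →
      (∀ g, (s' g).init = ν g) → (∀ g, ∀ t < T, (s g).toFun t = (s' g).toFun t) →
      ∀ g, ∀ t < T + δ, (Φ s g).toFun t = (Φ s' g).toFun t := fun s s' T hs hs' h g => by
    refine (hΦ s g).eq_of_lt (hΦ s' g) (hδ' g) (fun j => ?_) fun j t ht => ?_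
    · simp only [init_elim, hs, hs']
    · rcases C.src g j with p | g'
      · rfl
      · exact h g' t ht
  set s : ℕ → C.Node → Signal := fun n => Φ^[n] fun g =>
    ⟨fun _ => ν g, ν g, fun _ _ => rfl, fun _ _ => Eventually.of_forall fun _ => rfl,
      fun _ _ => ⟨ν g, Eventually.of_forall fun _ => rfl⟩⟩ with hs
  have hsucc : ∀ n, s (n + 1) = Φ (s n) := fun n => Function.iterate_succ_apply' _ _ _
  have hinit : ∀ n g, (s n g).init = ν g := fun n => by
    induction n with
    | zero => exact fun g => rfl
    | succ n ih => rw [hsucc]; exact hΦinit _ ih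
  have hstab : ∀ n : ℕ, ∀ g, ∀ t < n * δ, (s (n + 1) g).toFun t = (s n g).toFun t := fun n => by
    induction n with
    | zero =>
      intro g t ht
      have ht : t < 0 := by simpa using ht
      rw [(s _ g).eq_init t ht, (s _ g).eq_init t ht, hinit, hinit]
    | succ n ih =>
      intro g t ht
      have := hΦcausal (s (n + 1)) (s n) (n * δ) (hinit _) (hinit _) ih g t
        (by push_cast at ht; linarith)
      rwa [← hsucc, ← hsucc] at this
  choose S hS₀ hS using fun g =>
    Signal.exists_limit (fun n => s n g) hδ (fun n => hinit n g) fun n => hstab n g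
  have hfix : ∀ g, Φ S g = S g := fun g => by
    refine Signal.ext_of_toFun ((hΦinit S hS₀ g).trans (hS₀ g).symm) fun t => ?_
    obtain ⟨n, hn⟩ := exists_nat_gt (t / δ)
    rw [div_lt_iff₀ hδ] at hn
    have ht : t < (n + 1 : ℕ) * δ := by push_cast; linarith
    rw [hS g (n + 1) t ht, hsucc]
    exact hΦcausal S (s n) (n * δ) hS₀ (hinit n) (fun g t ht => hS g n t ht) g t (by linarith)
  exact ⟨⟨inp, S, fun o => Sum.elim inp S (C.outSrc o), fun _ => rfl, fun g => hfix g ▸ hΦ S g⟩,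
    rfl, hS₀⟩

/-- Executions with common initial values depend continuously on the input signals. -/
lemma ae_eventually_out_eq (hC : C.StrictlyCausal) {κ : Type*} {l : Filter κ}
    [l.IsCountablyGenerated] {ek : κ → C.Execution} {e : C.Execution}
    (hinp₀ : ∀ k p, ((ek k).inp p).init = (e.inp p).init)
    (hnode₀ : ∀ k g, ((ek k).node g).init = (e.node g).init)
    (hconv : ∀ p, ∀ᵐ t, ∀ᶠ k in l, ((ek k).inp p).toFun t = (e.inp p).toFun t)
    (o : C.OutPort) : ∀ᵐ t, ∀ᶠ k in l, ((ek k).out o).toFun t = (e.out o).toFun t := by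
  obtain ⟨δ, hδ, hδ'⟩ := hC.exists_pos_le_delay
  have key : ∀ n : ℕ, ∀ g, ∀ᵐ t, t < n * δ →
      ∀ᶠ k in l, ((ek k).node g).toFun t = (e.node g).toFun t := fun n => by
    induction n with
    | zero =>
      refine fun g => Eventually.of_forall fun t ht => Eventually.of_forall fun k => ?_
      have ht : t < 0 := by simpa using ht
      rw [((ek k).node g).eq_init t ht, (e.node g).eq_init t ht, hnode₀]
    | succ n ih =>
      intro g
      have := Gate.ae_eventually_output_eq (l := l) (T := n * δ) (hδ' g) (fun k j => ?_)
        (e.gate_out g)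
        (fun k => (ek k).gate_out g) (fun j => ?_)
      · filter_upwards [this] with t ht ht'
        exact ht (by push_cast at ht'; linarith)
      · simp only [init_elim, hinp₀, hnode₀]
      · rcases C.src g j with p | g'
        · filter_upwards [hconv p] with t ht _ using ht
        · exact ih g'
  have hnode : ∀ g, ∀ᵐ t, ∀ᶠ k in l, ((ek k).node g).toFun t = (e.node g).toFun t := fun g => by
    filter_upwards [MeasureTheory.ae_all_iff.2 fun n => key n g] with t ht
    obtain ⟨n, hn⟩ := exists_nat_gt (t / δ)
    exact ht n ((div_lt_iff₀ hδ).1 hn)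
  simp only [Execution.out_eq]
  rcases C.outSrc o with p | g
  · exact hconv p
  · exact hnode g

end Circuit

/-! ### Bounded Short-Pulse Filtration -/

lemma Signal.ae_eventually_pulse_eq {T₀ : ℝ} (hT₀ : 0 ≤ T₀) {κ : Type*} {l : Filter κ} {Δk : κ → ℝ}
    {Δ : ℝ} (hΔ : Tendsto Δk l (𝓝 Δ)) :
    ∀ᵐ t, ∀ᶠ k in l, (pulse T₀ (Δk k) hT₀).toFun t = (pulse T₀ Δ hT₀).toFun t := by
  filter_upwards [MeasureTheory.measure_eq_zero_iff_ae_notMem.1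
    (MeasureTheory.measure_singleton (T₀ + Δ))] with t ht
  have hlim : Tendsto (fun k => T₀ + Δk k) l (𝓝 (T₀ + Δ)) := hΔ.const_add T₀
  rcases lt_or_gt_of_ne (show t ≠ T₀ + Δ from ht) with h | h
  · filter_upwards [hlim.eventually_const_lt h] with k hk
    simp [pulse, h, hk]
  · filter_upwards [hlim.eventually_lt_const h] with k hk
    simp [pulse, not_lt.2 h.le, not_lt.2 hk.le]

/-- If a nonzero signal must be `1` throughout some interval of length `ε` inside a fixed bounded
interval, then every signal of a family that converges almost everywhere to the zero signal is
eventually zero. -/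
lemma eventually_forall_eq_false {κ : Type*} {l : Filter κ} {sk : κ → Signal} {B ε : ℝ}
    (hε : 0 < ε) (hlong : ∀ k t, (sk k).toFun t = true →
      ∃ t₀ ∈ Icc 0 B, ∀ u ∈ Icc t₀ (t₀ + ε), (sk k).toFun u = true)
    (hconv : ∀ᵐ t, ∀ᶠ k in l, (sk k).toFun t = false) :
    ∀ᶠ k in l, ∀ t, (sk k).toFun t = false := by
  -- points of convergence, one in each cell of a grid of mesh `ε / 2`
  have hgrid : ∀ n : ℕ, ∃ u, (∀ᶠ k in l, (sk k).toFun u = false) ∧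
      u ∈ Ioo (n * (ε / 2)) ((n + 1) * (ε / 2)) := fun n => by
    obtain ⟨u, hu, hu'⟩ := (MeasureTheory.Measure.dense_of_ae hconv).exists_between
      (show (n * (ε / 2) : ℝ) < (n + 1) * (ε / 2) by gcongr; linarith)
    exact ⟨u, hu, hu'⟩
  choose p hp hp' using hgrid
  have hall : ∀ᶠ k in l, ∀ n ∈ Finset.range (⌈B / (ε / 2)⌉₊ + 1), (sk k).toFun (p n) = false :=
    (Finset.eventually_all _).2 fun n _ => hp n
  filter_upwards [hall] with k hk t
  by_contra hne
  obtain ⟨t₀, ht₀, htrue⟩ := hlong k t (by simpa using hne)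
  have hε2 : 0 < ε / 2 := half_pos hε
  set n := ⌈t₀ / (ε / 2)⌉₊
  have h1 : t₀ ≤ n * (ε / 2) := (div_le_iff₀ hε2).1 (Nat.le_ceil _)
  have h2 : n * (ε / 2) < t₀ + ε / 2 := by
    have := Nat.ceil_lt_add_one (div_nonneg ht₀.1 hε2.le)
    rw [← lt_div_iff₀ hε2, add_div, div_self hε2.ne']
    exact this
  have hn : n ∈ Finset.range (⌈B / (ε / 2)⌉₊ + 1) := by
    rw [Finset.mem_range, Nat.lt_succ_iff]
    exact Nat.ceil_mono (div_le_div_of_nonneg_right ht₀.2 hε2.le)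
  have h3 := hp' n
  have := htrue (p n) ⟨h1.trans h3.1.le, by linarith [h3.2]⟩
  simp [hk n hn] at this

/-- Among the pulse lengths in `[0, Δ₁]`, those with a nonzero output form a clopen set that
contains `Δ₁` but not `0`. -/
theorem Circuit.StrictlyCausal.not_solvesBoundedSPF {C : Circuit} (hC : C.StrictlyCausal) :
    ¬ C.SolvesBoundedSPF := by
  intro hspf
  obtain ⟨e₁, T₀, Δ₁, hpulse, o, hne⟩ := hspf.nontriviality
  obtain ⟨ε, hε, hshort⟩ := hspf.noShortPulses
  obtain ⟨K, hK, hbound⟩ := hspf.boundedStabilization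
  obtain ⟨p₀⟩ : Nonempty C.InPort := (Nat.card_pos_iff.1 (hspf.wellFormed.1 ▸ one_pos)).1
  have hΔ₁ : 0 < Δ₁ := (hpulse p₀).2.1.1
  have hT₀ : 0 ≤ T₀ := (hpulse p₀).2.1.2.1.nonneg (hpulse p₀).1
  have hinp₁ : ∀ p, e₁.inp p = Signal.pulse T₀ Δ₁ hT₀ := fun p =>
    Signal.ext_of_toFun (hpulse p).1 (hpulse p).toFun_eq
  have hν : C.IsConsistentInit (fun _ => false) fun g => (e₁.node g).init := by
    have := e₁.isConsistentInit
    simp only [hinp₁] at this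
    exact this
  -- executions for all pulse lengths up to `Δ₁`, with the initial values of `e₁`; the one for the
  -- length `Δ₁` is `e₁` itself
  have hex : ∀ Δ : Icc 0 Δ₁, ∃ e : C.Execution, (∀ p, e.inp p = Signal.pulse T₀ Δ hT₀) ∧
      (∀ g, (e.node g).init = (e₁.node g).init) ∧ (Δ.1 = Δ₁ → e = e₁) := fun Δ => by
    by_cases h : Δ.1 = Δ₁
    · exact ⟨e₁, by rwa [h], fun _ => rfl, fun _ => rfl⟩
    · obtain ⟨e, he, he'⟩ :=
        Circuit.exists_execution hC (fun _ => Signal.pulse T₀ Δ hT₀) hν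
      exact ⟨e, fun p => by rw [he], he', fun h' => absurd h' h⟩
  choose E hEinp hEnode hE₁ using hex
  have h0mem : (0 : ℝ) ∈ Icc 0 Δ₁ := ⟨le_rfl, hΔ₁.le⟩
  have h1mem : Δ₁ ∈ Icc 0 Δ₁ := ⟨hΔ₁.le, le_rfl⟩
  have hEpulse : ∀ Δ, 0 < Δ.1 → (E Δ).PulseInput T₀ Δ := fun Δ hΔ p => by
    rw [hEinp]
    exact Signal.isPulse_of_toFun_eq hΔ rfl fun t => rfl
  have hzero := hspf.noGeneration (E ⟨0, h0mem⟩) (fun p => by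
    rw [hEinp, Signal.isZero_iff]
    refine ⟨rfl, fun t => ?_⟩
    simp [Signal.pulse]) o
  have hinit : ∀ Δ, ((E Δ).out o).init = false := fun Δ => by
    rw [← hzero.1]
    simp only [Circuit.Execution.out_eq, Circuit.init_elim, hEinp, hEnode]
    rfl
  set A : Set (Icc 0 Δ₁) := {Δ | ∃ t, ((E Δ).out o).toFun t = true} with hA
  have h0A : ∀ Δ ∈ A, 0 < Δ.1 := fun Δ ⟨t, ht⟩ => by
    refine lt_of_le_of_ne Δ.2.1 fun h => ?_
    obtain rfl : (⟨0, h0mem⟩ : Icc 0 Δ₁) = Δ := Subtype.ext h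
    simp [(Signal.isZero_iff.1 hzero).2 t] at ht
  have h1A : (⟨Δ₁, h1mem⟩ : Icc 0 Δ₁) ∈ A := by
    by_contra hcon
    refine hne ?_
    rw [← hE₁ ⟨Δ₁, h1mem⟩ rfl, Signal.isZero_iff]
    exact ⟨hinit _, fun t => by_contra fun h => hcon ⟨t, by simpa using h⟩⟩
  have hlong : ∀ Δ : Icc 0 Δ₁, ∀ t, ((E Δ).out o).toFun t = true → ∃ t₀ ∈ Icc 0 (T₀ + Δ₁ + K),
      ∀ u ∈ Icc t₀ (t₀ + ε), ((E Δ).out o).toFun u = true := fun Δ t ht => by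
    have hp := hEpulse Δ (h0A Δ ⟨t, ht⟩)
    obtain ⟨t₀, hr⟩ := Signal.exists_rising (hinit Δ) ht
    have hb := hbound (E Δ) T₀ Δ hp o t₀ (Or.inl hr)
    exact ⟨t₀, ⟨hr.nonneg (hinit Δ), by linarith [Δ.2.2]⟩, fun u hu =>
      hr.eq_true (fun l hl => hshort (E Δ) T₀ Δ hp o t₀ l hl) hu⟩
  have hconv : ∀ Δ, ∀ᵐ t, ∀ᶠ Δ' in 𝓝 Δ,
      ((E Δ').out o).toFun t = ((E Δ).out o).toFun t := fun Δ => by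
    refine Circuit.ae_eventually_out_eq hC (fun k p => ?_) (fun k g => ?_) (fun p => ?_) o
    · rw [hEinp, hEinp]; rfl
    · rw [hEnode, hEnode]
    · simp only [hEinp]
      exact Signal.ae_eventually_pulse_eq hT₀ continuousAt_subtype_val
  have hopen : IsOpen A := isOpen_iff_mem_nhds.2 fun Δ ⟨t, ht⟩ => by
    obtain ⟨r, htr, hr⟩ :=
      exists_Ioo_of_eventually_nhdsGT (((E Δ).out o).regulated.right t)
    obtain ⟨u, hu, hur⟩ := (MeasureTheory.Measure.dense_of_ae (hconv Δ)).exists_between htr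
    filter_upwards [hu] with Δ' hΔ'
    exact ⟨u, by rw [hΔ', hr u hur, ht]⟩
  have hclosed : IsClosed A := isOpen_compl_iff.1 <| isOpen_iff_mem_nhds.2 fun Δ hΔ => by
    have hΔ0 : ∀ t, ((E Δ).out o).toFun t = false := fun t =>
      by_contra fun h => hΔ ⟨t, by simpa using h⟩
    filter_upwards [eventually_forall_eq_false hε hlong
      (by simpa only [hΔ0] using hconv Δ)] with Δ' hΔ' ⟨t, ht⟩
    simp [hΔ' t] at ht
  have : PreconnectedSpace (Icc 0 Δ₁) := Subtype.preconnectedSpace isPreconnected_Icc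
  have huniv := IsClopen.eq_univ ⟨hclosed, hopen⟩ ⟨_, h1A⟩
  exact (h0A ⟨0, h0mem⟩ (huniv ▸ mem_univ _)).false

end HybridCircuit

theorem mainTheorem4 (C : HybridCircuit.Circuit) (hC : C.StrictlyCausal) :
    ¬ C.SolvesBoundedSPF := hC.not_solvesBoundedSPF
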